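/- Let $X$ be an $n$-dimensional complex manifold (Hausdorff, second countable), let $E\to X$ be a holomorphic vector bundle of finite rank $r$, and let $h$ be a singular Hermitian metric on $E$, i.e. a measurable family of non-negative Hermitian forms on the fibers (values $+\infty$ allowed) with $0<\det h<+\infty$ almost everywhere. Assume that $h$ is Griffiths semi-positive: for every local holomorphic section $\xi$ of the dual bundle $E^\star$, the function $|\xi|_{h^\star}$ (norm for the dual metric) is plurisubharmonic. For an open set $W\subset X$, say that $h$ is *globally Nakano semi-positive on $W$* if $h$ is Griffiths semi-positive on $W$ and the following holds for every Stein open subset $\Omega\subset W$ over which $E$ is trivial, every Kähler form $\omega$ on $\Omega$, every smooth strictly plurisubharmonic function $\psi$ on $\Omega$ and every integer $1\le q\le n$: for every $\bar\partial$-closed $f\in L^2_{(n,q)}(\Omega,E;\omega,he^{-\psi})$ such that $$\int_\Omega\langle B_{\omega,\psi}^{-1}f,f\rangle_{(\omega,h)}e^{-\psi}\,dV_\omega<+\infty,$$ where $B_{\omega,\psi}=[\sqrt{-1}\,\partial\bar\partial\psi\otimes \mathrm{Id}_E,\Lambda_\omega]$ ($\Lambda_\omega$ is the adjoint of $\omega\wedge\cdot$)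 and $dV_\omega=\omega^n/n!$, there is $u\in L^2_{(n,q-1)}(\Omega,E;\omega,he^{-\psi})$ with $\bar\partial u=f$ in the sense of distributions and $$\int_\Omega|u|^2_{(\omega,h)}e^{-\psi}\,dV_\omega\le\int_\Omega\langle B_{\omega,\psi}^{-1}f,f\rangle_{(\omega,h)}e^{-\psi}\,dV_\omega .$$ Let $S\subset X$ be a proper analytic subset, that is, an analytic subset containing no connected component of $X$ (if $X$ is connected and non-empty: $S\ne X$). Suppose that $X\setminus S$ is Stein and that $h$ is globally Nakano semi-positive on $X\setminus S$. Then $h$ is globally Nakano semi-positive on $X$. -/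

import Mathlib

open Set Filter Topology MeasureTheory Bundle
open scoped Manifold ContDiff ENNReal

noncomputable section

namespace SHM

/-! ### Linear algebra of forms on `ℂⁿ`, viewed as a real vector space -/

/-- The model space `ℂⁿ`. It is also the tangent space at `x` of an `n`-dimensional complex manifold
modelled on it (a tangent vector is read in the chart `chartAt _ x`, as everywhere in Mathlib). -/
abbrev Cn (n : ℕ) : Type := Fin n → ℂ

/-- Alternating real-multilinear `k`-forms on the real vector space underlying `ℂⁿ`, with values
in `F`. For `F = ℂ ^ r` these are the `k`-covectors with values in a trivialized bundle of
rank `r`. -/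
abbrev Form (n k : ℕ) (F : Type*) [NormedAddCommGroup F] [NormedSpace ℝ F] : Type _ :=
  (Cn n) [⋀^Fin k]→L[ℝ] F

/-- Multiplication by the imaginary unit on `ℂⁿ`, the complex structure. -/
def J (n : ℕ) : Cn n →L[ℝ] Cn n :=
  (Complex.I • ContinuousLinearMap.id ℂ (Cn n)).restrictScalars ℝ

/-- Bidegree: a form of degree `k = p + q` has type `(p, q)` if multiplying all its arguments by a
complex number `c` multiplies it by `c ^ p * conj c ^ q`. -/
def IsType {n k r : ℕ} (p q : ℕ) (α : Form n k (Cn r)) : Prop :=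
  ∀ (c : ℂ) (v : Fin k → Cn n),
    α (fun i => c • v i) = (c ^ p * (starRingEnd ℂ) c ^ q) • α v

/-- The complex-linear part of a real-linear map into a complex space. -/
def linPart {n : ℕ} {G : Type*} [NormedAddCommGroup G] [NormedSpace ℝ G] [NormedSpace ℂ G]
    [SMulCommClass ℝ ℂ G] (T : Cn n →L[ℝ] G) : Cn n →L[ℝ] G :=
  (1 / 2 : ℂ) • (T - Complex.I • T.comp (J n))

/-- The conjugate-linear part of a real-linear map into a complex space. -/
def conjPart {n : ℕ} {G : Type*} [NormedAddCommGroup G] [NormedSpace ℝ G] [NormedSpace ℂ G]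
    [SMulCommClass ℝ ℂ G] (T : Cn n →L[ℝ] G) : Cn n →L[ℝ] G :=
  (1 / 2 : ℂ) • (T + Complex.I • T.comp (J n))

/-- The exterior product `η ∧ α` of a scalar `1`-form `η` and a vector-valued `k`-form `α`,
as a real-linear function of `η`:
`(η ∧ α) (v₀, …, v_k) = ∑ i, (-1) ^ i • η (v i) • α (v₀, …, omit v i, …, v_k)`. -/
def wedgeOne {n k r : ℕ} (α : Form n k (Cn r)) : (Cn n →L[ℝ] ℂ) →L[ℝ] Form n (k + 1) (Cn r) :=
  ContinuousAlternatingMap.alternatizeUncurryFinCLM ℝ (Cn n) (Cn r) ∘L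
    ContinuousLinearMap.compL ℝ (Cn n) ℂ (Form n k (Cn r))
      ((ContinuousLinearMap.lsmul ℝ ℂ : ℂ →L[ℝ] Form n k (Cn r) →L[ℝ] Form n k (Cn r)).flip α)

/-- The exterior product `θ ∧ α` of a scalar `2`-form `θ`, given as an alternating bilinear map,
and a vector-valued `k`-form `α`. If `eᵢ` is a basis with dual basis `eⁱ`, then
`∑ i, eⁱ ∧ θ(eᵢ, ·) = 2 θ`, whence the factor `1 / 2`. -/
def wedgeTwo {n k r : ℕ} (θ : Cn n →L[ℝ] Cn n →L[ℝ] ℂ) (α : Form n k (Cn r)) :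
    Form n (k + 2) (Cn r) :=
  (1 / 2 : ℝ) • ContinuousAlternatingMap.alternatizeUncurryFin (wedgeOne α ∘L θ)

/-- `e` is an orthonormal basis of `ℂⁿ` (as a real vector space of dimension `2n`) for the
Riemannian metric `g(v, w) = κ(v, J w)` of the positive `(1,1)`-form `κ`. -/
def IsOrthonormalFor {n : ℕ} (κ : Form n 2 ℝ) (e : Fin n × Fin 2 → Cn n) : Prop :=
  ∀ i j, κ ![e i, J n (e j)] = if i = j then 1 else 0

/-- An orthonormal basis for the Riemannian metric of `κ`. It exists when `κ` is positive of type
`(1,1)`; nothing below that is built from it depends on which one is chosen. -/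
def onb {n : ℕ} (κ : Form n 2 ℝ) : Fin n × Fin 2 → Cn n :=
  Classical.epsilon (IsOrthonormalFor κ)

/-- The inner product of forms with values in `ℂ ^ r`, induced by the metric for which `e` is an
orthonormal basis and by the pairing `H` of values:
`⟨α, β⟩ = (1 / k!) ∑ H (α (e_{i₁}, …, e_{i_k})) (β (e_{i₁}, …, e_{i_k}))`. -/
def formInner {n k r : ℕ} (e : Fin n × Fin 2 → Cn n) (H : Cn r → Cn r → ℂ)
    (α β : Form n k (Cn r)) : ℂ :=
  ((Nat.factorial k : ℂ))⁻¹ * ∑ i : Fin k → Fin n × Fin 2, H (α (e ∘ i)) (β (e ∘ i))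

/-- The operator `Λ_κ`, in terms of an orthonormal basis `e`:
`(Λ α) (v₁, …, v_k) = (1 / 2) ∑ i, α (e i, J (e i), v₁, …, v_k)`. That it is the adjoint of
`κ ∧ ·` is shown in `formInner_wedgeTwo`. -/
def lam {n k r : ℕ} (e : Fin n × Fin 2 → Cn n) (α : Form n (k + 2) (Cn r)) : Form n k (Cn r) :=
  (1 / 2 : ℝ) • ∑ i, (α.curryLeft (e i)).curryLeft (J n (e i))

/-- Antisymmetrization is adjoint to contraction with the vectors of the basis. -/
theorem formInner_alternatize {n k r : ℕ} (e : Fin n × Fin 2 → Cn n)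
    (H : Cn r →ₗ[ℝ] Cn r →ₗ[ℝ] ℂ) (T : Cn n →L[ℝ] Form n k (Cn r))
    (β : Form n (k + 1) (Cn r)) :
    formInner e (fun a b => H a b) (ContinuousAlternatingMap.alternatizeUncurryFin T) β =
      ∑ j, formInner e (fun a b => H a b) (T (e j)) (β.curryLeft (e j)) := by
  have key : ∀ p : Fin (k + 1),
      ∑ i : Fin (k + 1) → Fin n × Fin 2,
        H (((-1 : ℤ) ^ (p : ℕ)) • T ((e ∘ i) p) (p.removeNth (e ∘ i))) (β (e ∘ i)) =
      ∑ j, ∑ i : Fin k → Fin n × Fin 2, H (T (e j) (e ∘ i)) (β.curryLeft (e j) (e ∘ i)) := by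
    intro p
    rw [← (Fin.insertNthEquiv (fun _ => Fin n × Fin 2) p).sum_comp, Fintype.sum_prod_type]
    refine Finset.sum_congr rfl fun j _ => Finset.sum_congr rfl fun i _ => ?_
    have h1 : e ∘ (p.insertNth j i : Fin (k + 1) → Fin n × Fin 2) =
        p.insertNth (e j) (e ∘ i) := by
      funext m
      refine Fin.succAboveCases p ?_ (fun m => ?_) m <;> simp
    change H (((-1 : ℤ) ^ (p : ℕ)) •
        T ((e ∘ (p.insertNth j i : Fin (k + 1) → Fin n × Fin 2)) p)
          (p.removeNth (e ∘ (p.insertNth j i : Fin (k + 1) → Fin n × Fin 2))))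
        (β (e ∘ (p.insertNth j i : Fin (k + 1) → Fin n × Fin 2))) = _
    rw [h1, ContinuousAlternatingMap.map_insertNth]
    rcases neg_one_pow_eq_or ℤ (p : ℕ) with h | h <;> simp [h]
  simp only [formInner, ContinuousAlternatingMap.alternatizeUncurryFin_apply, map_sum,
    LinearMap.sum_apply]
  rw [Finset.sum_comm]
  rw [Finset.sum_congr rfl fun p _ => key p]
  rw [Finset.sum_const, Finset.card_univ, Fintype.card_fin, ← Finset.mul_sum, nsmul_eq_mul,
    Nat.factorial_succ]
  have : (k.factorial : ℂ) ≠ 0 := by exact_mod_cast k.factorial_ne_zero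
  have h2 : ((k : ℂ) + 1) ≠ 0 := by exact_mod_cast k.succ_ne_zero
  push_cast
  field_simp

/-- The expansion of a vector in an orthonormal basis. -/
theorem IsOrthonormalFor.sum_eq {n : ℕ} {κ : Form n 2 ℝ} {e : Fin n × Fin 2 → Cn n}
    (he : IsOrthonormalFor κ e) (w : Cn n) : ∑ l, κ ![w, J n (e l)] • e l = w := by
  let φ : Fin n × Fin 2 → Cn n →ₗ[ℝ] ℝ := fun m =>
    { toFun := fun v => κ ![v, J n (e m)]
      map_add' := fun x y => by
        change κ.curryLeft (x + y) ![J n (e m)] = _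
        rw [map_add]; rfl
      map_smul' := fun c x => by
        change κ.curryLeft (c • x) ![J n (e m)] = _
        rw [map_smul]; rfl }
  have hφ : ∀ m l, φ m (e l) = if l = m then 1 else 0 := fun m l => he l m
  have li : LinearIndependent ℝ e := by
    rw [Fintype.linearIndependent_iff]
    intro a ha m
    have := congrArg (φ m) ha
    simpa [hφ] using this
  have hs : Submodule.span ℝ (Set.range e) = ⊤ := by
    apply li.span_eq_top_of_card_eq_finrank'
    rw [Module.finrank_pi_fintype]
    simp [Complex.finrank_real_complex]
  have hw : w ∈ Submodule.span ℝ (Set.range e) := hs ▸ Submodule.mem_top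
  obtain ⟨a, rfl⟩ := (Submodule.mem_span_range_iff_exists_fun ℝ).1 hw
  refine Finset.sum_congr rfl fun m _ => ?_
  have : φ m (∑ l, a l • e l) = a m := by simp [hφ]
  exact congrArg (· • e m) this

/-- `Λ` is the adjoint of the exterior product with `κ`. -/
theorem formInner_wedgeTwo {n k r : ℕ} {κ : Form n 2 ℝ} {e : Fin n × Fin 2 → Cn n}
    (he : IsOrthonormalFor κ e) (hκ : ∀ v w : Cn n, κ ![J n v, J n w] = κ ![v, w])
    (θ : Cn n →L[ℝ] Cn n →L[ℝ] ℂ) (hθ : ∀ v w, θ v w = (κ ![v, w] : ℂ))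
    (H : Cn r →ₗ[ℝ] Cn r →ₗ[ℝ] ℂ) (α : Form n k (Cn r)) (β : Form n (k + 2) (Cn r)) :
    formInner e (fun a b => H a b) (wedgeTwo θ α) β =
      formInner e (fun a b => H a b) α (lam e β) := by
  have hsum : ∀ j, ∑ l, κ ![e j, e l] • e l = J n (e j) := fun j => by
    simpa only [hκ] using he.sum_eq (J n (e j))
  have hsmulL : ∀ {m : ℕ} (c : ℝ) (a b : Form n m (Cn r)),
      formInner e (fun a b => H a b) (c • a) b = c • formInner e (fun a b => H a b) a b := by
    intro m c a b
    simp only [formInner, ContinuousAlternatingMap.smul_apply, map_smul, LinearMap.smul_apply,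
      ← Finset.smul_sum, mul_smul_comm]
  have hsmulR : ∀ {m : ℕ} (c : ℝ) (a b : Form n m (Cn r)),
      formInner e (fun a b => H a b) a (c • b) = c • formInner e (fun a b => H a b) a b := by
    intro m c a b
    simp only [formInner, ContinuousAlternatingMap.smul_apply, map_smul,
      ← Finset.smul_sum, mul_smul_comm]
  have hsumR : ∀ {m : ℕ} (a : Form n m (Cn r)) (b : Fin n × Fin 2 → Form n m (Cn r)),
      formInner e (fun a b => H a b) a (∑ j, b j) =
        ∑ j, formInner e (fun a b => H a b) a (b j) := by
    intro m a b
    simp only [formInner, ContinuousAlternatingMap.sum_apply, map_sum]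
    rw [Finset.sum_comm, Finset.mul_sum]
  have hone : ∀ (η : Cn n →L[ℝ] ℂ) (b : Form n (k + 1) (Cn r)),
      formInner e (fun a b => H a b) (wedgeOne α η) b =
        ∑ l, formInner e (fun a b => H a b) (η (e l) • α) (b.curryLeft (e l)) := by
    intro η b
    exact formInner_alternatize e H _ b
  rw [wedgeTwo, lam, hsmulL, hsmulR, formInner_alternatize, hsumR]
  congr 1
  refine Finset.sum_congr rfl fun j _ => ?_
  rw [ContinuousLinearMap.comp_apply, hone, ← hsum j, map_sum, hsumR]
  refine Finset.sum_congr rfl fun l _ => ?_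
  rw [map_smul, hsmulR, hθ, ← hsmulL]
  rfl

/-- The commutator `B = [θ ∧ ·, Λ_κ]` on forms of degree `k + 2`. -/
def commB {n k r : ℕ} (κ : Form n 2 ℝ) (θ : Cn n →L[ℝ] Cn n →L[ℝ] ℂ)
    (α : Form n (k + 2) (Cn r)) : Form n (k + 2) (Cn r) :=
  wedgeTwo θ (lam (onb κ) α) - lam (onb κ) (wedgeTwo θ α)

/-- The inverse of `B = [θ ∧ ·, Λ_κ]` on the space of forms of type `(n, q)`. -/
def commBInv {n k r : ℕ} (q : ℕ) (κ : Form n 2 ℝ) (θ : Cn n →L[ℝ] Cn n →L[ℝ] ℂ)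
    (α : Form n (k + 2) (Cn r)) : Form n (k + 2) (Cn r) :=
  Function.invFunOn (commB κ θ) {β : Form n (k + 2) (Cn r) | IsType n q β} α

/-- The Hermitian form (linear in the first variable) of the seminorm `N`, by polarization. -/
def polar {r : ℕ} (N : Cn r → ℝ≥0∞) (a b : Cn r) : ℂ :=
  (1 / 4 : ℂ) *
    ((((N (a + b) ^ 2).toReal - (N (a - b) ^ 2).toReal : ℝ) : ℂ) +
      Complex.I * (((N (a + Complex.I • b) ^ 2).toReal -
        (N (a - Complex.I • b) ^ 2).toReal : ℝ) : ℂ))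

/-- `√-1 ∂∂̄ψ` at `z`, as an alternating bilinear map: `√-1` times the antisymmetrization of the
complex-linear part of the derivative of the `(0,1)`-form `∂̄ψ`. -/
def ddbar {n : ℕ} (ψ : Cn n → ℝ) (z : Cn n) : Cn n →L[ℝ] Cn n →L[ℝ] ℂ :=
  let A := linPart (fderiv ℝ (fun y => conjPart (fderiv ℝ (fun w => (ψ w : ℂ)) y)) z)
  Complex.I • (A - A.flip)

/-! ### Forms, Kähler metrics and the `∂̄`-operator on a complex manifold -/

section Manifold

variable {n : ℕ} {X : Type*} [TopologicalSpace X] [ChartedSpace (Cn n) X]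

/-- The part of the image of the chart at `c` that corresponds to `U ⊆ X`. -/
def chartSet (n : ℕ) {X : Type*} [TopologicalSpace X] [ChartedSpace (Cn n) X] (c : X)
    (U : Set X) : Set (Cn n) :=
  (chartAt (Cn n) c).target ∩ (chartAt (Cn n) c).symm ⁻¹' U

/-- The derivative of the inverse of the chart at `c`, a linear map from `ℂⁿ` to the tangent space
of `X` at the point with coordinate `z`. -/
def chartDeriv (c : X) (z : Cn n) : Cn n →L[ℝ] Cn n :=
  let D : Cn n →L[ℂ] Cn n := mfderiv 𝓘(ℂ, Cn n) 𝓘(ℂ, Cn n) (chartAt (Cn n) c).symm z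
  D.restrictScalars ℝ

/-- The expression in the chart at `c` of a `k`-form on `X` (the pullback by the inverse of the
chart), a `k`-form on an open subset of `ℂⁿ`. -/
def pull {k : ℕ} {F : Type*} [NormedAddCommGroup F] [NormedSpace ℝ F] (c : X)
    (α : X → Form n k F) (z : Cn n) : Form n k F :=
  (α ((chartAt (Cn n) c).symm z)).compContinuousLinearMap (chartDeriv c z)

/-- `κ` is a Kähler form on the open set `Ω`: a smooth closed real `2`-form of type `(1,1)`,
positive on nonzero vectors. -/
structure IsKahlerOn (κ : X → Form n 2 ℝ) (Ω : Set X) : Prop where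
  smooth : ∀ c : X, ContDiffOn ℝ (∞ : ℕ∞ω) (pull c κ) (chartSet n c Ω)
  closed : ∀ c : X, ∀ z ∈ chartSet n c Ω, extDeriv (pull c κ) z = 0
  type : ∀ x ∈ Ω, ∀ v w : Cn n, κ x ![J n v, J n w] = κ x ![v, w]
  pos : ∀ x ∈ Ω, ∀ v : Cn n, v ≠ 0 → 0 < κ x ![v, J n v]

/-- The real basis of `ℂⁿ` formed by the standard basis and its multiples by the imaginary unit. -/
def stdBasis (n : ℕ) (i : Fin n × Fin 2) : Cn n :=
  Pi.single i.1 (Complex.I ^ (i.2 : ℕ))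

/-- The density, with respect to Lebesgue measure in the chart at `c`, of the Riemannian volume
`κ ^ n / n!` of `κ`: the square root of the determinant of the Gram matrix of the metric. -/
def volDensity (κ : X → Form n 2 ℝ) (c : X) (z : Cn n) : ℝ :=
  Real.sqrt (Matrix.det (Matrix.of fun i j : Fin n × Fin 2 =>
    pull c κ z ![stdBasis n i, J n (stdBasis n j)]))

/-- The volume measure `dV_κ = κ ^ n / n!`. It is the least measure that dominates, for each chart,
the measure with density `volDensity` there; as these measures agree where two charts overlap and
countably many charts cover `X`, it restricts to each of them on the domain of the chart. -/
def kahlerVolume [MeasurableSpace X] (κ : X → Form n 2 ℝ) : Measure X :=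
  ⨆ c : X, Measure.map (chartAt (Cn n) c).symm
    ((volume.restrict (chartAt (Cn n) c).target).withDensity
      fun z => ENNReal.ofReal (volDensity κ c z))

/-- `√-1 ∂∂̄ψ` at the point `x` of `X`. -/
def ddbarAt (ψ : X → ℝ) (x : X) : Cn n →L[ℝ] Cn n →L[ℝ] ℂ :=
  ddbar (ψ ∘ (chartAt (Cn n) x).symm) (chartAt (Cn n) x x)

/-- `ψ` is a smooth strictly plurisubharmonic function on the open set `Ω`. -/
def IsSmoothStrictlyPSHOn (n : ℕ) {X : Type*} [TopologicalSpace X] [ChartedSpace (Cn n) X]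
    (ψ : X → ℝ) (Ω : Set X) : Prop :=
  ContMDiffOn 𝓘(ℝ, Cn n) 𝓘(ℝ, ℝ) (∞ : ℕ∞ω) ψ Ω ∧
    ∀ x ∈ Ω, ∀ v : Cn n, v ≠ 0 → 0 < (ddbarAt ψ x v (J n v)).re

/-- `∂̄u = f` on the open set `Ω` in the sense of distributions, for locally integrable forms with
values in a trivialized holomorphic bundle: in each chart and for each smooth compactly supported
test function `χ`, `∫ χ f = - ∫ ∂̄χ ∧ u`. -/
def WeakDbarOn {k r : ℕ} (u : X → Form n k (Cn r)) (f : X → Form n (k + 1) (Cn r))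
    (Ω : Set X) : Prop :=
  ∀ c : X,
    LocallyIntegrableOn (pull c u) (chartSet n c Ω) ∧
    LocallyIntegrableOn (pull c f) (chartSet n c Ω) ∧
    ∀ χ : Cn n → ℂ, ContDiff ℝ (∞ : ℕ∞ω) χ → HasCompactSupport χ → tsupport χ ⊆ chartSet n c Ω →
      ∫ z, χ z • pull c f z = - ∫ z, wedgeOne (pull c u z) (conjPart (fderiv ℝ χ z))

/-- The open set `Ω ⊆ X` is a Stein manifold: it is holomorphically convex (the holomorphic hull
in `Ω` of a compact set is compact) and global holomorphic functions separate its points. -/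
def IsSteinOn (n : ℕ) {X : Type*} [TopologicalSpace X] [ChartedSpace (Cn n) X]
    (Ω : Set X) : Prop :=
  IsOpen Ω ∧
  (∀ K ⊆ Ω, IsCompact K →
    IsCompact {x | x ∈ Ω ∧ ∀ g : X → ℂ, MDifferentiableOn 𝓘(ℂ, Cn n) 𝓘(ℂ, ℂ) g Ω →
      ∃ y ∈ K, ‖g x‖ ≤ ‖g y‖}) ∧
  (∀ x ∈ Ω, ∀ y ∈ Ω, x ≠ y →
    ∃ g : X → ℂ, MDifferentiableOn 𝓘(ℂ, Cn n) 𝓘(ℂ, ℂ) g Ω ∧ g x ≠ g y)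

/-- `S` is an analytic subset of `X`: near each point of `X` it is the set of common zeros of
finitely many holomorphic functions. -/
def IsAnalyticSubset (n : ℕ) {X : Type*} [TopologicalSpace X] [ChartedSpace (Cn n) X]
    (S : Set X) : Prop :=
  ∀ x : X, ∃ U : Set X, IsOpen U ∧ x ∈ U ∧ ∃ (m : ℕ) (g : Fin m → X → ℂ),
    (∀ i, MDifferentiableOn 𝓘(ℂ, Cn n) 𝓘(ℂ, ℂ) (g i) U) ∧
    S ∩ U = {y | y ∈ U ∧ ∀ i, g i y = 0}

/-- A function with values in `[0, ∞]` is plurisubharmonic on the open set `U`: it is finite and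
upper semicontinuous, and satisfies the submean value inequality on each disc in a complex line
in each chart. -/
def IsPSHOn (n : ℕ) {X : Type*} [TopologicalSpace X] [ChartedSpace (Cn n) X]
    (φ : X → ℝ≥0∞) (U : Set X) : Prop :=
  UpperSemicontinuousOn φ U ∧ (∀ x ∈ U, φ x ≠ ⊤) ∧
  ∀ (c : X) (z w : Cn n), (∀ ζ : ℂ, ‖ζ‖ ≤ 1 → z + ζ • w ∈ chartSet n c U) →
    φ ((chartAt (Cn n) c).symm z) ≤
      (ENNReal.ofReal (2 * Real.pi))⁻¹ * ∫⁻ t in Ioc (0 : ℝ) (2 * Real.pi),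
        φ ((chartAt (Cn n) c).symm (z + Complex.exp (t * Complex.I) • w))

end Manifold

/-! ### Singular Hermitian metrics on a holomorphic vector bundle -/

section Bundle

variable {n r : ℕ} {X : Type*} [TopologicalSpace X] [ChartedSpace (Cn n) X]
  {E : X → Type*} [∀ x, AddCommGroup (E x)] [∀ x, Module ℂ (E x)]
  [TopologicalSpace (TotalSpace (Cn r) E)] [∀ x, TopologicalSpace (E x)]
  [FiberBundle (Cn r) E]

/-- The section `s` of `E` is holomorphic on the open set `U`. -/
def HolSectionOn (n r : ℕ) {X : Type*} [TopologicalSpace X] [ChartedSpace (Cn n) X]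
    {E : X → Type*} [∀ x, AddCommGroup (E x)] [∀ x, Module ℂ (E x)]
    [TopologicalSpace (TotalSpace (Cn r) E)] [∀ x, TopologicalSpace (E x)]
    [FiberBundle (Cn r) E] (s : ∀ x, E x) (U : Set X) : Prop :=
  MDifferentiableOn 𝓘(ℂ, Cn n) (𝓘(ℂ, Cn n).prod 𝓘(ℂ, Cn r))
    (fun x => TotalSpace.mk' (Cn r) x (s x)) U

/-- The section `ξ` of the dual bundle is holomorphic on the open set `U`: its pairing with each
local holomorphic section of `E` is holomorphic. -/
def HolDualSectionOn (n r : ℕ) {X : Type*} [TopologicalSpace X] [ChartedSpace (Cn n) X]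
    {E : X → Type*} [∀ x, AddCommGroup (E x)] [∀ x, Module ℂ (E x)]
    [TopologicalSpace (TotalSpace (Cn r) E)] [∀ x, TopologicalSpace (E x)]
    [FiberBundle (Cn r) E] (ξ : ∀ x, E x →ₗ[ℂ] ℂ) (U : Set X) : Prop :=
  ∀ (V : Set X) (s : ∀ x, E x), IsOpen V → V ⊆ U → HolSectionOn n r s V →
    MDifferentiableOn 𝓘(ℂ, Cn n) 𝓘(ℂ, ℂ) (fun x => ξ x (s x)) V

/-- `s` is a holomorphic frame of `E` over the open set `Ω`, that is, a trivialization of `E`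
over `Ω`. -/
def HolFrameOn (n : ℕ) {r : ℕ} {X : Type*} [TopologicalSpace X] [ChartedSpace (Cn n) X]
    {E : X → Type*} [∀ x, AddCommGroup (E x)] [∀ x, Module ℂ (E x)]
    [TopologicalSpace (TotalSpace (Cn r) E)] [∀ x, TopologicalSpace (E x)]
    [FiberBundle (Cn r) E] (s : Fin r → ∀ x, E x) (Ω : Set X) : Prop :=
  (∀ i, HolSectionOn n r (s i) Ω) ∧ ∀ x ∈ Ω, LinearIndependent ℂ (fun i => s i x)

variable (n r E) in
/-- A singular Hermitian metric on `E`: a measurable family of non-negative Hermitian forms on the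
fibers, which may take the value `∞` on vectors, and which is finite and positive definite almost
everywhere (that is, `0 < det h < ∞` almost everywhere). It is given by the associated seminorms
`v ↦ |v|_h` with values in `[0, ∞]`; that these come from Hermitian forms is the parallelogram
law. -/
structure SingularHermitianMetric where
  /-- The length `|v|_h` of a vector. -/
  norm : ∀ x, E x → ℝ≥0∞
  norm_smul : ∀ (x : X) (a : ℂ) (v : E x), norm x (a • v) = ‖a‖ₑ * norm x v
  norm_add_le : ∀ (x : X) (v w : E x), norm x (v + w) ≤ norm x v + norm x w
  parallelogram : ∀ (x : X) (v w : E x),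
    norm x (v + w) ^ 2 + norm x (v - w) ^ 2 = 2 * (norm x v ^ 2 + norm x w ^ 2)
  measurable : ∀ (U : Set X) (s : ∀ x, E x), IsOpen U → HolSectionOn n r s U → ∀ c : X,
    AEMeasurable (fun z => norm ((chartAt (Cn n) c).symm z) (s ((chartAt (Cn n) c).symm z)))
      (volume.restrict (chartSet n c U))
  finite_pos : ∀ c : X, ∀ᵐ z ∂(volume.restrict (chartAt (Cn n) c).target),
    ∀ v : E ((chartAt (Cn n) c).symm z), v ≠ 0 →
      0 < norm ((chartAt (Cn n) c).symm z) v ∧ norm ((chartAt (Cn n) c).symm z) v < ⊤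

namespace SingularHermitianMetric

variable (h : SingularHermitianMetric n r E)

/-- The length `|ξ|_{h*} = sup {|ξ(v)| : |v|_h ≤ 1}` of a covector for the dual metric. -/
def dualNorm (x : X) (ξ : E x →ₗ[ℂ] ℂ) : ℝ≥0∞ :=
  ⨆ (v : E x) (_ : h.norm x v ≤ 1), ‖ξ v‖ₑ

/-- `h` is Griffiths semi-positive over the open set `W`: the dual metric is Griffiths
semi-negative, that is, `|ξ|_{h*}` is plurisubharmonic for each local holomorphic section `ξ` of
the dual bundle. -/
def GriffithsSemipositiveOn (W : Set X) : Prop :=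
  ∀ (U : Set X) (ξ : ∀ x, E x →ₗ[ℂ] ℂ), IsOpen U → U ⊆ W → HolDualSectionOn n r ξ U →
    IsPSHOn n (fun x => h.dualNorm x (ξ x)) U

/-- The pointwise inner product `⟨α, β⟩_{(κ, h)}` at `x` of two `E`-valued forms, written in the
frame `s`. -/
def inner {k : ℕ} (s : Fin r → ∀ x, E x) (κ : X → Form n 2 ℝ) (x : X)
    (α β : Form n k (Cn r)) : ℂ :=
  formInner (onb (κ x)) (polar fun a => h.norm x (∑ i, a i • s i x)) α β

/-- The integral over `Ω` of `⟨α, β⟩_{(κ, h)} e^{-ψ} dV_κ`, for `α` and `β` whose inner product is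
real and non-negative. -/
def energy [MeasurableSpace X] {k : ℕ} (s : Fin r → ∀ x, E x) (κ : X → Form n 2 ℝ) (ψ : X → ℝ)
    (Ω : Set X) (α β : X → Form n k (Cn r)) : ℝ≥0∞ :=
  ∫⁻ x in Ω, ENNReal.ofReal ((h.inner s κ x (α x) (β x)).re * Real.exp (-ψ x)) ∂(kahlerVolume κ)

/-- `α` belongs to `L²_{(p,q)}(Ω, E; κ, h e^{-ψ})`. -/
def MemL2 [MeasurableSpace X] {k : ℕ} (p q : ℕ) (s : Fin r → ∀ x, E x) (κ : X → Form n 2 ℝ)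
    (ψ : X → ℝ) (Ω : Set X) (α : X → Form n k (Cn r)) : Prop :=
  (∀ x ∈ Ω, IsType p q (α x)) ∧
  (∀ c : X, AEStronglyMeasurable (pull c α) (volume.restrict (chartSet n c Ω))) ∧
  h.energy s κ ψ Ω α α < ⊤

/-- `h` is globally Nakano semi-positive over the open submanifold `W` of `X`: it is Griffiths
semi-positive there, and for each Stein open set `Ω ⊆ W` (the image of a Stein coordinate of `W`)
over which `E` is trivial, each Kähler form `κ` and each smooth strictly plurisubharmonic function
`ψ` on `Ω`, each `1 ≤ q ≤ n` and each `∂̄`-closed `f ∈ L²_{(n,q)}(Ω, E; κ, h e^{-ψ})`, the equation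
`∂̄u = f` has a solution `u ∈ L²_{(n,q-1)}(Ω, E; κ, h e^{-ψ})` with
`∫ |u|² e^{-ψ} dV ≤ ∫ ⟨B⁻¹ f, f⟩ e^{-ψ} dV`, `B = [√-1 ∂∂̄ψ ⊗ Id, Λ_κ]`, if the right-hand side is
finite. Here `k + 2 = n + q` is the degree of `f`. -/
def GloballyNakanoSemipositiveOn [MeasurableSpace X] (W : Set X) : Prop :=
  h.GriffithsSemipositiveOn W ∧
  ∀ (Ω : Set X) (s : Fin r → ∀ x, E x) (κ : X → Form n 2 ℝ) (ψ : X → ℝ),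
    Ω ⊆ W → IsSteinOn n Ω → HolFrameOn n s Ω → IsKahlerOn κ Ω → IsSmoothStrictlyPSHOn n ψ Ω →
    ∀ (q k : ℕ), 1 ≤ q → q ≤ n → k + 2 = n + q →
    ∀ f : X → Form n (k + 2) (Cn r),
      h.MemL2 n q s κ ψ Ω f → WeakDbarOn f 0 Ω →
      h.energy s κ ψ Ω (fun x => commBInv q (κ x) (ddbarAt ψ x) (f x)) f < ⊤ →
      ∃ u : X → Form n (k + 1) (Cn r),
        h.MemL2 n (q - 1) s κ ψ Ω u ∧ WeakDbarOn u f Ω ∧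
        h.energy s κ ψ Ω u u ≤
          h.energy s κ ψ Ω (fun x => commBInv q (κ x) (ddbarAt ψ x) (f x)) f

end SingularHermitianMetric

end Bundle

end SHM

end

/-!
Let `Ω` be a Stein open subset of `X`, with data as in the definition of global Nakano
semi-positivity. The intersection of two Stein open sets is Stein (`IsSteinOn.inter`), so
`Ω \ S` is a Stein open subset of `X \ S`, and the hypothesis solves `∂̄u = f` there with the
required estimate. An analytic subset that contains no connected component has empty interior, by
the identity theorem (`IsAnalyticSubset.interior_eq_empty`), hence it is a null set in each chart
and for the Kähler volume (`kahlerVolume_eq_zero`). The integrals over `Ω \ S` are therefore the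
integrals over `Ω`, and it remains to see that `u`, extended by zero, solves `∂̄u = f` across `S`.

This is the removable singularity theorem for square integrable solutions, provided that `u` is
locally square integrable in coordinates up to `S`. The latter is where Griffiths semi-positivity
on all of `X` enters: the dual metric is plurisubharmonic on the sections of the dual frame of a
holomorphic frame, hence locally bounded above, so `h` is locally bounded below by a positive
multiple of the standard metric of the frame (`GriffithsSemipositiveOn.exists_lower_bound`,
`exists_nhds_memLp_pull`). No completeness of `Ω \ S` is needed.

For the removable singularity theorem (`weak_dbar_across_zeros`, `weak_dbar_extend`) the set is
locally contained in the zero set of a single holomorphic function `g` with `|g| ≤ 1`. The equation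
is tested against `v_j χ`, with `v_j` smooth cutoff functions that vanish near the zero set of `g`
and tend to `1` off it. The error term `∫ χ ∂̄v_j ∧ u` is at most `‖u‖ ‖χ ∂̄v_j‖` in `L²`, so cutoff
functions of small Dirichlet energy are needed. These are convex functions of `1 + (j + 1)⁻¹ log
|g|` (`exists_cutoff_sequence`): as `log |g|` is pluriharmonic off the zeros of `g`, they are
plurisubharmonic with values in `[0, 1]`, and the Caccioppoli inequality (`integral_energy_le`)
bounds their energy by `½ ∫ v_j² Δη` for a test function `η`, which tends to `½ ∫ Δη = 0`. No
resolution or stratification of `S` is used.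
-/

noncomputable section

namespace SHM

/-! ### Holomorphic functions of several complex variables -/

/-- The directional derivatives of a complex differentiable function of several variables are
complex differentiable: by Cauchy's formula on a small disc in the direction `e`, the derivative
is an integral of translates of `g`, which can be differentiated under the integral sign. -/
theorem differentiableOn_fderiv_apply {n : ℕ} {g : Cn n → ℂ} {V : Set (Cn n)} (hV : IsOpen V)
    (hg : DifferentiableOn ℂ g V) (e : Cn n) :
    DifferentiableOn ℂ (fun z => fderiv ℂ g z e) V := by
  intro z₀ hz₀
  obtain ⟨R, hR, hball⟩ : ∃ R > 0, Metric.closedBall z₀ (3 * R) ⊆ V := by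
    obtain ⟨ε, hε, h⟩ := Metric.nhds_basis_closedBall.mem_iff.1 (hV.mem_nhds hz₀)
    exact ⟨ε / 3, by positivity, by rwa [mul_div_cancel₀ _ (three_ne_zero)]⟩
  obtain ⟨ρ, hρ, hρe⟩ : ∃ ρ > 0, ρ * ‖e‖ ≤ R := by
    refine ⟨R / (‖e‖ + 1), by positivity, ?_⟩
    rw [div_mul_eq_mul_div, div_le_iff₀ (by positivity)]
    nlinarith [norm_nonneg e]
  obtain ⟨M, hM⟩ : ∃ M, ∀ y ∈ Metric.closedBall z₀ (3 * R), ‖g y‖ ≤ M :=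
    (isCompact_closedBall z₀ (3 * R)).exists_bound_of_continuousOn
      (hg.continuousOn.mono hball)
  have hmem : ∀ z ∈ Metric.ball z₀ R, ∀ ζ : ℂ, ‖ζ‖ ≤ ρ →
      z + ζ • e ∈ Metric.closedBall z₀ (2 * R) := by
    intro z hz ζ hζ
    rw [mem_closedBall_iff_norm]
    rw [mem_ball_iff_norm] at hz
    calc ‖z + ζ • e - z₀‖ = ‖(z - z₀) + ζ • e‖ := by congr 1; abel
      _ ≤ ‖z - z₀‖ + ‖ζ‖ * ‖e‖ := (norm_add_le _ _).trans (by rw [norm_smul])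
      _ ≤ R + ρ * ‖e‖ := by gcongr
      _ ≤ 2 * R := by linarith
  have hsub : Metric.closedBall z₀ (2 * R) ⊆ V :=
    (Metric.closedBall_subset_closedBall (by linarith)).trans hball
  have hM' : ∀ y ∈ Metric.closedBall z₀ (2 * R), ‖fderiv ℂ g y‖ ≤ 2 * M / R := by
    intro y hy
    have hyb : Metric.ball y R ⊆ Metric.closedBall z₀ (3 * R) := by
      intro w hw
      rw [Metric.mem_closedBall] at *
      rw [Metric.mem_ball] at hw
      linarith [dist_triangle w y z₀]
    refine Complex.norm_fderiv_le_div_of_mapsTo_ball (hg.mono (hyb.trans hball)) ?_ hR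
    intro w hw
    rw [mem_closedBall_iff_norm]
    have h1 := hM w (hyb hw)
    have h2 := hM y (hyb (Metric.mem_ball_self hR))
    linarith [norm_sub_le (g w) (g y)]
  have hcirc : ∀ t : ℝ, ‖circleMap 0 ρ t‖ ≤ ρ := by
    intro t; simp [abs_of_pos hρ]
  have hne : ∀ t : ℝ, circleMap 0 ρ t ≠ 0 := fun t => circleMap_ne_center hρ.ne'
  -- Cauchy's formula for the derivative of `ζ ↦ g (z + ζ e)` at `0`.
  have hcauchy : ∀ z ∈ Metric.ball z₀ R, fderiv ℂ g z e = (2 * Real.pi * Complex.I : ℂ)⁻¹ •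
      ∫ t in (0 : ℝ)..2 * Real.pi, (deriv (circleMap 0 ρ) t * (1 / (circleMap 0 ρ t) ^ 2)) •
        g (z + circleMap 0 ρ t • e) := by
    intro z hz
    have hline : ∀ ζ ∈ Metric.closedBall (0 : ℂ) ρ,
        DifferentiableAt ℂ (fun ζ : ℂ => g (z + ζ • e)) ζ := by
      intro ζ hζ
      have h1 : DifferentiableAt ℂ g (z + ζ • e) :=
        hg.differentiableAt (hV.mem_nhds (hsub (hmem z hz ζ (by simpa using hζ))))
      exact DifferentiableAt.comp ζ h1 (by fun_prop)
    have hd : DiffContOnCl ℂ (fun ζ : ℂ => g (z + ζ • e)) (Metric.ball 0 ρ) := by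
      apply DifferentiableOn.diffContOnCl
      intro ζ hζ
      exact (hline ζ (Metric.closure_ball_subset_closedBall hζ)).differentiableWithinAt
    have h2 := hd.deriv_eq_smul_circleIntegral hρ
    have h3 : deriv (fun ζ : ℂ => g (z + ζ • e)) 0 = fderiv ℂ g z e := by
      have hgz : HasFDerivAt g (fderiv ℂ g z) (z + (0 : ℂ) • e) := by
        rw [zero_smul, add_zero]
        exact (hg.differentiableAt (hV.mem_nhds (hsub (by
          simpa using hmem z hz 0 (by simpa using hρ.le))))).hasFDerivAt
      have hl : HasDerivAt (fun ζ : ℂ => z + ζ • e) e 0 := by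
        simpa using ((hasDerivAt_id (0 : ℂ)).smul_const e).const_add z
      exact (hgz.comp_hasDerivAt (0 : ℂ) hl).deriv
    rw [h3] at h2
    have h4 : (2 * Real.pi * Complex.I : ℂ) ≠ 0 := by
      simp [Real.pi_ne_zero]
    rw [eq_inv_smul_iff₀ h4, ← h2, circleIntegral]
    simp only [sub_zero, smul_smul]
  have hcont : Continuous fun t : ℝ =>
      deriv (circleMap 0 ρ) t * (1 / (circleMap 0 ρ t) ^ 2) := by
    simp only [deriv_circleMap]
    refine Continuous.mul (by fun_prop) (continuous_const.div (by fun_prop) fun t => ?_)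
    exact pow_ne_zero _ (hne t)
  have hgcont : ∀ z ∈ Metric.ball z₀ R, Continuous fun t : ℝ => g (z + circleMap 0 ρ t • e) := by
    intro z hz
    rw [← continuousOn_univ]
    refine ContinuousOn.comp (t := V) hg.continuousOn (by fun_prop) ?_
    intro t _
    exact hsub (hmem z hz _ (hcirc t))
  have key := intervalIntegral.hasFDerivAt_integral_of_dominated_of_fderiv_le (𝕜 := ℂ)
    (μ := volume) (a := 0) (b := 2 * Real.pi) (x₀ := z₀)
    (F := fun z t => (deriv (circleMap 0 ρ) t * (1 / (circleMap 0 ρ t) ^ 2)) •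
        g (z + circleMap 0 ρ t • e))
    (F' := fun z t => (deriv (circleMap 0 ρ) t * (1 / (circleMap 0 ρ t) ^ 2)) •
        fderiv ℂ g (z + circleMap 0 ρ t • e))
    (bound := fun t => ‖deriv (circleMap 0 ρ) t * (1 / (circleMap 0 ρ t) ^ 2)‖ * (2 * M / R))
    (s := Metric.ball z₀ R) (Metric.ball_mem_nhds z₀ hR)
    (by
      filter_upwards [Metric.ball_mem_nhds z₀ hR] with z hz
      exact (hcont.smul (hgcont z hz)).aestronglyMeasurable)
    ((hcont.smul (hgcont z₀ (Metric.mem_ball_self hR))).intervalIntegrable _ _)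
    (by
      refine hcont.aestronglyMeasurable.smul ?_
      have : Measurable fun t : ℝ => fderiv ℂ g (z₀ + circleMap 0 ρ t • e) :=
        (measurable_fderiv ℂ g).comp (by
          have : Continuous fun t : ℝ => z₀ + circleMap 0 ρ t • e := by fun_prop
          exact this.measurable)
      exact this.aestronglyMeasurable)
    (by
      refine Eventually.of_forall fun t _ z hz => ?_
      rw [norm_smul]
      gcongr
      exact hM' _ (hmem z hz _ (hcirc t)))
    ((hcont.norm.mul continuous_const).intervalIntegrable _ _)
    (by
      refine Eventually.of_forall fun t _ z hz => ?_
      have h1 : HasFDerivAt g (fderiv ℂ g (z + circleMap 0 ρ t • e)) (z + circleMap 0 ρ t • e) :=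
        (hg.differentiableAt (hV.mem_nhds (hsub (hmem z hz _ (hcirc t))))).hasFDerivAt
      exact ((hasFDerivAt_comp_add_right _).2 h1).fun_const_smul
        (deriv (circleMap 0 ρ) t * (1 / (circleMap 0 ρ t) ^ 2)))
  have hev : (fun z => fderiv ℂ g z e) =ᶠ[𝓝 z₀] fun z => (2 * Real.pi * Complex.I : ℂ)⁻¹ •
      ∫ t in (0 : ℝ)..2 * Real.pi, (deriv (circleMap 0 ρ) t * (1 / (circleMap 0 ρ t) ^ 2)) •
        g (z + circleMap 0 ρ t • e) := by
    filter_upwards [Metric.ball_mem_nhds z₀ hR] with z hz using hcauchy z hz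
  exact ((key.differentiableAt.fun_const_smul
    (2 * Real.pi * Complex.I : ℂ)⁻¹).congr_of_eventuallyEq hev).differentiableWithinAt

/-- Complex differentiable functions of several variables are smooth. -/
theorem contDiffOn_of_differentiableOn {n : ℕ} {V : Set (Cn n)} (hV : IsOpen V) {g : Cn n → ℂ}
    (hg : DifferentiableOn ℂ g V) : ContDiffOn ℂ (∞ : ℕ∞ω) g V := by
  rw [contDiffOn_infty]
  intro m
  induction m generalizing g with
  | zero => exact contDiffOn_zero.2 hg.continuousOn
  | succ m ih =>
    have : ((m + 1 : ℕ) : ℕ∞ω) = (m : ℕ∞ω) + 1 := by norm_cast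
    rw [this, contDiffOn_succ_iff_fderiv_of_isOpen hV]
    refine ⟨hg, by simp, ?_⟩
    rw [contDiffOn_clm_apply]
    exact fun e => ih (differentiableOn_fderiv_apply hV hg e)

/-- A measurable set that does not contain `p` and meets every ray from `p` in a null set is a null
set: integrate in polar coordinates. (For `n = 0` the set `{p}` is not a null set.) -/
theorem measure_eq_zero_of_rays {n : ℕ} (p : Cn n) {N : Set (Cn n)} (hN : MeasurableSet N)
    (hray : ∀ v : Cn n, ‖v‖ = 1 → volume {t : ℝ | 0 < t ∧ p + t • v ∈ N} = 0) :
    p ∈ N ∨ volume N = 0 := by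
  refine or_iff_not_imp_left.2 fun hp => ?_
  let N' : Set (Cn n) := (fun w => p + w) ⁻¹' N
  have hN' : MeasurableSet N' := hN.preimage (measurable_const_add p)
  have hvol : volume N' = volume N := measure_preimage_add volume p N
  rw [← hvol]
  have h0 : N' = (Subtype.val : ({0}ᶜ : Set (Cn n)) → Cn n) '' (Subtype.val ⁻¹' N') := by
    rw [Subtype.image_preimage_coe, eq_comm, inter_eq_right]
    rintro w hw rfl
    exact hp (by simpa [N'] using hw)
  rw [h0, ← comap_subtype_coe_apply (measurableSet_singleton _).compl]
  have hmp := Measure.measurePreserving_homeomorphUnitSphereProd (volume : Measure (Cn n))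
  let A : Set (Metric.sphere (0 : Cn n) 1 × Ioi (0 : ℝ)) :=
    (homeomorphUnitSphereProd (Cn n)).symm ⁻¹' (Subtype.val ⁻¹' N')
  have hA : MeasurableSet A :=
    (hN'.preimage measurable_subtype_coe).preimage (Homeomorph.measurable _)
  have hpre : homeomorphUnitSphereProd (Cn n) ⁻¹' A = Subtype.val ⁻¹' N' := by
    ext w; simp [A]
  rw [← hpre, hmp.measure_preimage hA.nullMeasurableSet, Measure.measure_prod_null hA]
  refine Eventually.of_forall fun v => ?_
  have hac : Measure.volumeIoiPow (Module.finrank ℝ (Cn n) - 1) ≪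
      Measure.comap (Subtype.val : Ioi (0 : ℝ) → ℝ) volume := withDensity_absolutelyContinuous _ _
  refine hac ?_
  rw [comap_subtype_coe_apply measurableSet_Ioi]
  refine measure_mono_null ?_ (hray v (by simp))
  rintro _ ⟨t, ht, rfl⟩
  refine ⟨t.2, ?_⟩
  simpa [A, N'] using ht

/-- A holomorphic function on a ball either vanishes identically or has a zero set of measure
zero: along each ray from a point where it does not vanish, its zeros are isolated. -/
theorem eqOn_zero_or_volume_zeros_eq_zero {n : ℕ} {g : Cn n → ℂ} {x : Cn n} {R : ℝ}
    (hg : DifferentiableOn ℂ g (Metric.ball x R)) :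
    (∀ z ∈ Metric.ball x R, g z = 0) ∨ volume {z | z ∈ Metric.ball x R ∧ g z = 0} = 0 := by
  by_cases h0 : ∀ z ∈ Metric.ball x R, g z = 0
  · exact Or.inl h0
  right
  push Not at h0
  obtain ⟨p, hp, hgp⟩ := h0
  have hmeas : MeasurableSet {z | z ∈ Metric.ball x R ∧ g z = 0} := by
    have h1 : IsOpen (Metric.ball x R ∩ g ⁻¹' {0}ᶜ) :=
      hg.continuousOn.isOpen_inter_preimage Metric.isOpen_ball isOpen_compl_singleton
    have h2 : {z | z ∈ Metric.ball x R ∧ g z = 0} =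
        Metric.ball x R \ (Metric.ball x R ∩ g ⁻¹' {0}ᶜ) := by
      ext z; simp +contextual
    rw [h2]
    exact Metric.isOpen_ball.measurableSet.diff h1.measurableSet
  refine (measure_eq_zero_of_rays p hmeas ?_).resolve_left fun h => hgp h.2
  intro v _
  let T : Set ℂ := (fun ζ : ℂ => p + ζ • v) ⁻¹' Metric.ball x R
  have hTopen : IsOpen T := Metric.isOpen_ball.preimage (by fun_prop)
  have hTconv : Convex ℝ T := by
    intro a ha b hb s t hs ht hst
    have h1 : p + (s • a + t • b) • v = s • (p + a • v) + t • (p + b • v) := by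
      calc p + (s • a + t • b) • v = (s + t) • p + (s • a + t • b) • v := by rw [hst, one_smul]
        _ = s • (p + a • v) + t • (p + b • v) := by
          rw [add_smul, add_smul, smul_assoc, smul_assoc, smul_add, smul_add]; abel
    have h2 := convex_ball x R ha hb hs ht hst
    rw [← h1] at h2
    exact h2
  have hd : DifferentiableOn ℂ (fun ζ : ℂ => g (p + ζ • v)) T :=
    DifferentiableOn.comp (g := g) (f := fun ζ : ℂ => p + ζ • v) hg (by fun_prop) fun ζ hζ => hζ
  have han := hd.analyticOnNhd hTopen
  have hT0 : (0 : ℂ) ∈ T := by simpa [T] using hp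
  apply measure_null_of_locally_null
  rintro t ⟨-, htb, htz⟩
  have htT : (t : ℂ) ∈ T := by simpa [T] using htb
  have hnot : ¬ ∃ᶠ ζ in 𝓝[≠] (t : ℂ), g (p + ζ • v) = 0 := by
    intro hfr
    have := han.eqOn_zero_of_preconnected_of_frequently_eq_zero hTconv.isPreconnected htT hfr hT0
    exact hgp (by simpa using this)
  rw [not_frequently] at hnot
  have hev : ∀ᶠ s : ℝ in 𝓝[≠] t, ¬ g (p + (s : ℂ) • v) = 0 := by
    have : Tendsto (fun s : ℝ => (s : ℂ)) (𝓝[≠] t) (𝓝[≠] (t : ℂ)) := by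
      refine tendsto_nhdsWithin_iff.2 ⟨?_, ?_⟩
      · exact (Complex.continuous_ofReal.tendsto t).mono_left nhdsWithin_le_nhds
      · filter_upwards [self_mem_nhdsWithin] with s hs
        simpa using hs
    exact this.eventually hnot
  rw [eventually_nhdsWithin_iff] at hev
  refine ⟨_ ∩ {s : ℝ | 0 < s ∧ p + s • v ∈ {z | z ∈ Metric.ball x R ∧ g z = 0}},
    inter_mem (mem_nhdsWithin_of_mem_nhds hev) self_mem_nhdsWithin, ?_⟩
  refine measure_mono_null ?_ (measure_singleton t)
  rintro s ⟨hs, -, -, hs0⟩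
  by_contra hne
  refine hs hne ?_
  simpa using hs0

/-! ### Plurisubharmonic cutoff functions along a zero set -/

/-- The second derivative of `w` at `z` in the direction `a`. -/
def secondDeriv {n : ℕ} (a : Cn n) (w : Cn n → ℝ) (z : Cn n) : ℝ :=
  fderiv ℝ (fun y => fderiv ℝ w y a) z a

/-- There is a smooth convex function that vanishes on `(-∞, 0]` and has the value `1` at `1`: a
double primitive of `expNegInvGlue`. -/
theorem exists_convex_profile : ∃ m : ℝ → ℝ, ContDiff ℝ (∞ : ℕ∞ω) m ∧ (∀ t ≤ 0, m t = 0) ∧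
    (∀ t ≤ 1, 0 ≤ m t ∧ m t ≤ 1) ∧ m 1 = 1 ∧ ∀ t, 0 ≤ deriv (deriv m) t := by
  let p : (ℝ → ℝ) → ℝ → ℝ := fun φ t => ∫ s in (0 : ℝ)..t, φ s
  have hd : ∀ φ, Continuous φ → ∀ t, HasDerivAt (p φ) (φ t) t := fun φ hφ t =>
    (hφ.integral_hasStrictDerivAt 0 t).hasDerivAt
  have hderiv : ∀ φ, Continuous φ → deriv (p φ) = φ := fun φ hφ => funext fun t => (hd φ hφ t).deriv
  have hsmooth : ∀ φ, ContDiff ℝ (∞ : ℕ∞ω) φ → ContDiff ℝ (∞ : ℕ∞ω) (p φ) := by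
    intro φ hφ
    rw [contDiff_infty_iff_deriv, hderiv φ hφ.continuous]
    exact ⟨fun t => (hd φ hφ.continuous t).differentiableAt, hφ⟩
  have hzero : ∀ φ : ℝ → ℝ, (∀ t ≤ 0, φ t = 0) → ∀ t ≤ 0, p φ t = 0 := by
    intro φ hφ t ht
    have : ∫ s in (0 : ℝ)..t, φ s = ∫ s in (0 : ℝ)..t, (0 : ℝ) := by
      apply intervalIntegral.integral_congr
      intro s hs
      rw [uIcc_of_ge ht] at hs
      exact hφ s hs.2
    simp only [p, this, intervalIntegral.integral_zero]
  have hpos : ∀ φ : ℝ → ℝ, Continuous φ → (∀ t > 0, 0 < φ t) → ∀ t > 0, 0 < p φ t := by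
    intro φ hc hφ t ht
    exact intervalIntegral.intervalIntegral_pos_of_pos_on (hc.intervalIntegrable _ _)
      (fun s hs => hφ s hs.1) ht
  have h0 : ContDiff ℝ (∞ : ℕ∞ω) expNegInvGlue := expNegInvGlue.contDiff
  have h1 := hsmooth _ h0
  have h2 := hsmooth _ h1
  let q := p (p expNegInvGlue)
  have hp1 : ∀ t > 0, 0 < p expNegInvGlue t := hpos _ h0.continuous fun t ht =>
    expNegInvGlue.pos_of_pos ht
  have hz1 : ∀ t ≤ 0, p expNegInvGlue t = 0 := hzero _ fun t ht =>
    expNegInvGlue.zero_of_nonpos ht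
  have hq1 : 0 < q 1 := hpos _ h1.continuous hp1 1 one_pos
  have hz2 : ∀ t ≤ 0, q t = 0 := hzero _ hz1
  have hp1' : ∀ t, 0 ≤ p expNegInvGlue t := fun t =>
    (le_or_gt t 0).elim (fun h => (hz1 t h).ge) fun h => (hp1 t h).le
  have hmono : Monotone q := by
    apply monotone_of_deriv_nonneg (h2.differentiable (by simp))
    intro t
    rw [hderiv _ h1.continuous]
    exact hp1' t
  refine ⟨fun t => q t / q 1, h2.div_const _, fun t ht => by simp [hz2 t ht], fun t ht => ⟨?_, ?_⟩,
    div_self hq1.ne', fun t => ?_⟩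
  · refine div_nonneg ?_ hq1.le
    rcases le_or_gt t 0 with h | h
    · exact (hz2 t h).ge
    · exact (hz2 0 le_rfl).ge.trans (hmono h.le)
  · exact (div_le_one hq1).2 (hmono ht)
  · have e1 : deriv (fun t => q t / q 1) = fun t => p expNegInvGlue t / q 1 := by
      funext s
      rw [deriv_div_const, hderiv _ h1.continuous]
    rw [e1, deriv_div_const, hderiv _ h0.continuous]
    exact div_nonneg (expNegInvGlue.nonneg t) hq1.le

/-- A continuous function on an open set, multiplied by a continuous function with compact support
in that set, is continuous and compactly supported. -/
theorem continuous_mul_of_tsupport_subset {E : Type*} [TopologicalSpace E] {V : Set E}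
    (hV : IsOpen V) {η f : E → ℝ} (hη : Continuous η) (hηV : tsupport η ⊆ V)
    (hf : ContinuousOn f V) : Continuous fun z => η z * f z := by
  rw [continuous_iff_continuousAt]
  intro z
  by_cases hz : z ∈ tsupport η
  · exact hη.continuousAt.mul (hf.continuousAt (hV.mem_nhds (hηV hz)))
  · have : (fun z => η z * f z) =ᶠ[𝓝 z] fun _ => 0 := by
      filter_upwards [(isClosed_tsupport η).isOpen_compl.mem_nhds hz] with y hy
      simp [image_eq_zero_of_notMem_tsupport hy]
    exact (continuousAt_const (y := (0 : ℝ))).congr this.symm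

theorem integrable_mul_of_tsupport_subset {n : ℕ} {V : Set (Cn n)}
    (hV : IsOpen V) {η f : Cn n → ℝ} (hη : Continuous η) (hc : HasCompactSupport η)
    (hηV : tsupport η ⊆ V) (hf : ContinuousOn f V) : Integrable fun z => η z * f z :=
  (continuous_mul_of_tsupport_subset hV hη hηV hf).integrable_of_hasCompactSupport hc.mul_right

theorem contDiffOn_fderiv_apply {n : ℕ} {V : Set (Cn n)} (hV : IsOpen V) {w : Cn n → ℝ}
    (hw : ContDiffOn ℝ (∞ : ℕ∞ω) w V) (a : Cn n) :
    ContDiffOn ℝ (∞ : ℕ∞ω) (fun z => fderiv ℝ w z a) V :=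
  (hw.fderiv_of_isOpen hV (m := (∞ : ℕ∞ω)) le_rfl).clm_apply contDiffOn_const

/-- Integration by parts, twice, in the direction `a`. -/
theorem integral_mul_secondDeriv {n : ℕ} {V : Set (Cn n)} (hV : IsOpen V) {η w : Cn n → ℝ}
    (hη : ContDiff ℝ (∞ : ℕ∞ω) η) (hc : HasCompactSupport η) (hηV : tsupport η ⊆ V)
    (hw : ContDiffOn ℝ (∞ : ℕ∞ω) w V) (a : Cn n) :
    ∫ z, η z * secondDeriv a w z = ∫ z, w z * secondDeriv a η z := by
  have hw1 := contDiffOn_fderiv_apply hV hw a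
  have hw2 := contDiffOn_fderiv_apply hV hw1 a
  have hη1 : ContDiff ℝ (∞ : ℕ∞ω) fun z => fderiv ℝ η z a := by
    rw [← contDiffOn_univ] at hη ⊢
    exact contDiffOn_fderiv_apply isOpen_univ hη a
  have hη2 : ContDiff ℝ (∞ : ℕ∞ω) fun z => fderiv ℝ (fun y => fderiv ℝ η y a) z a := by
    rw [← contDiffOn_univ] at hη1 ⊢
    exact contDiffOn_fderiv_apply isOpen_univ hη1 a
  have hc1 : HasCompactSupport fun z => fderiv ℝ η z a := hc.fderiv_apply ℝ a
  have hc2 : HasCompactSupport fun z => fderiv ℝ (fun y => fderiv ℝ η y a) z a :=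
    hc1.fderiv_apply ℝ a
  have hs1 : tsupport (fun z => fderiv ℝ η z a) ⊆ V :=
    (tsupport_fderiv_apply_subset ℝ a).trans hηV
  have hs2 : tsupport (fun z => fderiv ℝ (fun y => fderiv ℝ η y a) z a) ⊆ V :=
    (tsupport_fderiv_apply_subset ℝ a).trans hs1
  have hdiff : ∀ {f : Cn n → ℝ}, ContDiffOn ℝ (∞ : ℕ∞ω) f V → ∀ z ∈ V, DifferentiableAt ℝ f z :=
    fun hf z hz => (hf.contDiffAt (hV.mem_nhds hz)).differentiableAt (by simp)
  have e1 : ∫ z, η z * fderiv ℝ (fun y => fderiv ℝ w y a) z a =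
      - ∫ z, fderiv ℝ η z a * fderiv ℝ w z a :=
    integral_mul_fderiv_eq_neg_fderiv_mul_of_integrable
      (integrable_mul_of_tsupport_subset hV hη1.continuous hc1 hs1 hw1.continuousOn)
      (integrable_mul_of_tsupport_subset hV hη.continuous hc hηV hw2.continuousOn)
      (integrable_mul_of_tsupport_subset hV hη.continuous hc hηV hw1.continuousOn)
      (fun z _ => hη.differentiable (by simp) z) (fun z hz => hdiff hw1 z (hηV hz))
  have e2 : ∫ z, fderiv ℝ η z a * fderiv ℝ w z a =
      - ∫ z, fderiv ℝ (fun y => fderiv ℝ η y a) z a * w z :=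
    integral_mul_fderiv_eq_neg_fderiv_mul_of_integrable
      (integrable_mul_of_tsupport_subset hV hη2.continuous hc2 hs2 hw.continuousOn)
      (integrable_mul_of_tsupport_subset hV hη1.continuous hc1 hs1 hw1.continuousOn)
      (integrable_mul_of_tsupport_subset hV hη1.continuous hc1 hs1 hw.continuousOn)
      (fun z _ => hη1.differentiable (by simp) z) (fun z hz => hdiff hw z (hs1 hz))
  simp only [secondDeriv]
  rw [e1, e2, neg_neg]
  simp only [mul_comm]

/-- The Caccioppoli inequality: the Dirichlet energy of a non-negative function `v` that is
subharmonic along the complex line spanned by `e` is controlled by the size of `v`, because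
`Δ(v²) ≥ 2 |∇v|²`. -/
theorem integral_energy_le {n : ℕ} {V : Set (Cn n)} (hV : IsOpen V) {η v : Cn n → ℝ}
    (hη : ContDiff ℝ (∞ : ℕ∞ω) η) (hc : HasCompactSupport η) (hηV : tsupport η ⊆ V)
    (hη0 : ∀ z, 0 ≤ η z) (hv : ContDiffOn ℝ (∞ : ℕ∞ω) v V) (e : Cn n)
    (hsub : ∀ z ∈ V, 0 ≤ v z * (secondDeriv e v z + secondDeriv (J n e) v z)) :
    ∫ z, η z * (fderiv ℝ v z e ^ 2 + fderiv ℝ v z (J n e) ^ 2) ≤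
      (1 / 2) * ∫ z, v z ^ 2 * (secondDeriv e η z + secondDeriv (J n e) η z) := by
  have hv2 : ContDiffOn ℝ (∞ : ℕ∞ω) (fun z => v z ^ 2) V := hv.pow 2
  have hdiff : ∀ z ∈ V, DifferentiableAt ℝ v z :=
    fun z hz => (hv.contDiffAt (hV.mem_nhds hz)).differentiableAt (by simp)
  have hsec : ∀ a, ∀ z ∈ V, secondDeriv a (fun z => v z ^ 2) z =
      2 * fderiv ℝ v z a ^ 2 + 2 * (v z * secondDeriv a v z) := by
    intro a z hz
    have h1 : (fun y => fderiv ℝ (fun z => v z ^ 2) y a) =ᶠ[𝓝 z]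
        fun y => 2 * (v y * fderiv ℝ v y a) := by
      filter_upwards [hV.mem_nhds hz] with y hy
      rw [fderiv_fun_pow 2 (hdiff y hy)]
      simp; ring
    have h2 : DifferentiableAt ℝ (fun y => fderiv ℝ v y a) z :=
      ((contDiffOn_fderiv_apply hV hv a).contDiffAt (hV.mem_nhds hz)).differentiableAt (by simp)
    rw [secondDeriv, h1.fderiv_eq, fderiv_const_mul ((hdiff z hz).fun_mul h2),
      fderiv_fun_mul (hdiff z hz) h2]
    simp [secondDeriv]; ring
  have hcont2 : ∀ a {f : Cn n → ℝ}, ContDiffOn ℝ (∞ : ℕ∞ω) f V →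
      ContinuousOn (secondDeriv a f) V := fun a f hf =>
    (contDiffOn_fderiv_apply hV (contDiffOn_fderiv_apply hV hf a) a).continuousOn
  have hint : ∀ a, Integrable fun z => η z * secondDeriv a (fun z => v z ^ 2) z := fun a =>
    integrable_mul_of_tsupport_subset hV hη.continuous hc hηV (hcont2 a hv2)
  have hint' : ∀ a, Integrable fun z => v z ^ 2 * secondDeriv a η z := by
    intro a
    have hη1 : ContDiff ℝ (∞ : ℕ∞ω) fun z => fderiv ℝ η z a := by
      rw [← contDiffOn_univ] at hη ⊢
      exact contDiffOn_fderiv_apply isOpen_univ hη a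
    have hη2 : ContDiff ℝ (∞ : ℕ∞ω) fun z => fderiv ℝ (fun y => fderiv ℝ η y a) z a := by
      rw [← contDiffOn_univ] at hη1 ⊢
      exact contDiffOn_fderiv_apply isOpen_univ hη1 a
    have h := integrable_mul_of_tsupport_subset hV hη2.continuous
      ((hc.fderiv_apply ℝ a).fderiv_apply ℝ a)
      (((tsupport_fderiv_apply_subset ℝ a).trans (tsupport_fderiv_apply_subset ℝ a)).trans hηV)
      hv2.continuousOn
    simpa only [mul_comm, secondDeriv] using h
  have hE : Integrable fun z => η z * (fderiv ℝ v z e ^ 2 + fderiv ℝ v z (J n e) ^ 2) :=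
    integrable_mul_of_tsupport_subset hV hη.continuous hc hηV
      (((contDiffOn_fderiv_apply hV hv e).continuousOn.pow 2).add
        ((contDiffOn_fderiv_apply hV hv (J n e)).continuousOn.pow 2))
  have hle : ∫ z, 2 * (η z * (fderiv ℝ v z e ^ 2 + fderiv ℝ v z (J n e) ^ 2)) ≤
      ∫ z, (η z * secondDeriv e (fun z => v z ^ 2) z +
        η z * secondDeriv (J n e) (fun z => v z ^ 2) z) := by
    refine integral_mono (hE.const_mul 2) ((hint e).add (hint (J n e))) fun z => ?_
    by_cases hz : z ∈ V
    · have h1 := hsub z hz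
      have h2 := hη0 z
      simp only [hsec _ z hz]
      nlinarith [mul_nonneg h2 h1]
    · simp [image_eq_zero_of_notMem_tsupport fun h => hz (hηV h)]
  rw [integral_const_mul, integral_add (hint e) (hint (J n e)),
    integral_mul_secondDeriv hV hη hc hηV hv2, integral_mul_secondDeriv hV hη hc hηV hv2,
    ← integral_add (hint' e) (hint' (J n e))] at hle
  simp only [mul_add]
  simp only [mul_add] at hle
  linarith

/-- The second derivatives of a composition with a function of one real variable. -/
theorem secondDeriv_comp {n : ℕ} {m : ℝ → ℝ} (hm : ContDiff ℝ (∞ : ℕ∞ω) m) {p : Cn n → ℝ}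
    {z : Cn n} (hp : ContDiffAt ℝ (∞ : ℕ∞ω) p z) (a : Cn n) :
    secondDeriv a (fun y => m (p y)) z =
      deriv (deriv m) (p z) * fderiv ℝ p z a ^ 2 + deriv m (p z) * secondDeriv a p z := by
  have hm1 := (contDiff_infty_iff_deriv.1 hm).2
  have hev : ∀ᶠ y in 𝓝 z, DifferentiableAt ℝ p y := by
    have h1 : ContDiffAt ℝ 1 p z := hp.of_le (by exact_mod_cast le_top)
    filter_upwards [h1.eventually (by simp)] with y hy using hy.differentiableAt (by simp)
  have h1 : (fun y => fderiv ℝ (fun y => m (p y)) y a) =ᶠ[𝓝 z]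
      fun y => deriv m (p y) * fderiv ℝ p y a := by
    filter_upwards [hev] with y hy
    have hmy : HasDerivAt m (deriv m (p y)) (p y) := (hm.differentiable (by simp) _).hasDerivAt
    have h2 : fderiv ℝ (fun y => m (p y)) y = deriv m (p y) • fderiv ℝ p y :=
      (hmy.comp_hasFDerivAt y hy.hasFDerivAt).fderiv
    rw [h2]
    simp
  have h2 : DifferentiableAt ℝ (fun y => fderiv ℝ p y a) z := by
    have h3 : ContDiffAt ℝ 1 (fderiv ℝ p) z := hp.fderiv_right (m := 1) (by
      rw [one_add_one_eq_two]; exact WithTop.coe_le_coe.2 le_top)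
    exact (h3.differentiableAt (by simp)).clm_apply (differentiableAt_const a)
  have hmz : HasDerivAt (deriv m) (deriv (deriv m) (p z)) (p z) :=
    (hm1.differentiable (by simp) _).hasDerivAt
  have h4 := hmz.comp_hasFDerivAt z hev.self_of_nhds.hasFDerivAt
  have h5 := h4.mul h2.hasFDerivAt
  have h6 : fderiv ℝ (fun y => deriv m (p y) * fderiv ℝ p y a) z = _ := h5.fderiv
  rw [secondDeriv, h1.fderiv_eq, h6]
  simp [secondDeriv]; ring

/-- The logarithm of the modulus of a non-vanishing holomorphic function is smooth and harmonic on
complex lines. -/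
theorem pluriharmonic_log_norm {n : ℕ} {V : Set (Cn n)} (hV : IsOpen V) {g : Cn n → ℂ}
    (hg : DifferentiableOn ℂ g V) {z : Cn n} (hz : z ∈ V) (hgz : g z ≠ 0) :
    ContDiffAt ℝ (∞ : ℕ∞ω) (fun y => Real.log ‖g y‖) z ∧ ∀ e : Cn n,
      secondDeriv e (fun y => Real.log ‖g y‖) z +
        secondDeriv (J n e) (fun y => Real.log ‖g y‖) z = 0 := by
  let W : Set (Cn n) := V ∩ (fun y => g y / g z) ⁻¹' Complex.slitPlane
  have hW : IsOpen W :=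
    (hg.continuousOn.div_const _).isOpen_inter_preimage hV Complex.isOpen_slitPlane
  have hzW : z ∈ W := ⟨hz, by simp [hgz]⟩
  let ℓ : Cn n → ℂ := fun y => Complex.log (g y / g z)
  have hℓ : DifferentiableOn ℂ ℓ W := by
    intro y hy
    have : DifferentiableAt ℂ g y := hg.differentiableAt (hV.mem_nhds hy.1)
    have h1 : DifferentiableAt ℂ (fun y => g y / g z) y := by
      simpa only [div_eq_mul_inv] using this.mul_const (g z)⁻¹
    exact (h1.clog hy.2).differentiableWithinAt
  have hlog : ∀ y ∈ W, Real.log ‖g y‖ = (ℓ y).re + Real.log ‖g z‖ := by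
    intro y hy
    have hy0 : g y ≠ 0 := by
      intro h
      have := hy.2
      simp [h] at this
    rw [Complex.log_re, norm_div, Real.log_div (by simpa using hy0) (by simpa using hgz)]
    ring
  have hsm : ContDiffOn ℝ (∞ : ℕ∞ω) ℓ W := (contDiffOn_of_differentiableOn hW hℓ).restrict_scalars ℝ
  have hfd : ∀ {f : Cn n → ℂ}, DifferentiableOn ℂ f W → ∀ y ∈ W, ∀ a : Cn n,
      fderiv ℝ (fun y => (f y).re) y a = (fderiv ℂ f y a).re := by
    intro f hf y hy a
    have h1 : HasFDerivAt f (fderiv ℂ f y) y := (hf.differentiableAt (hW.mem_nhds hy)).hasFDerivAt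
    have h2 := (Complex.reCLM.hasFDerivAt (x := f y)).comp y (h1.restrictScalars ℝ)
    have h3 : fderiv ℝ (fun y => (f y).re) y =
        Complex.reCLM.comp ((fderiv ℂ f y).restrictScalars ℝ) := h2.fderiv
    rw [h3]; rfl
  have hev : ∀ᶠ y in 𝓝 z, y ∈ W := hW.mem_nhds hzW
  constructor
  · have h1 : ContDiffAt ℝ (∞ : ℕ∞ω) (fun y => (ℓ y).re + Real.log ‖g z‖) z :=
      (Complex.reCLM.contDiff.contDiffAt.comp z (hsm.contDiffAt hev)).add contDiffAt_const
    exact h1.congr_of_eventuallyEq (by filter_upwards [hev] with y hy using hlog y hy)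
  · intro e
    have hsec : ∀ a, secondDeriv a (fun y => Real.log ‖g y‖) z =
        (fderiv ℂ (fun y => fderiv ℂ ℓ y a) z a).re := by
      intro a
      have h1 : (fun y => fderiv ℝ (fun y => Real.log ‖g y‖) y a) =ᶠ[𝓝 z]
          fun y => (fderiv ℂ ℓ y a).re := by
        filter_upwards [hev] with y hy
        have h2 : (fun y => Real.log ‖g y‖) =ᶠ[𝓝 y] fun y => (ℓ y).re + Real.log ‖g z‖ := by
          filter_upwards [hW.mem_nhds hy] with x hx using hlog x hx
        rw [h2.fderiv_eq, fderiv_add_const, hfd hℓ y hy]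
      rw [secondDeriv, h1.fderiv_eq, hfd (differentiableOn_fderiv_apply hW hℓ a) z hzW]
    have hJ : J n e = Complex.I • e := rfl
    have hI : (fun y => fderiv ℂ ℓ y (Complex.I • e)) = fun y => Complex.I • fderiv ℂ ℓ y e := by
      funext y; rw [map_smul]
    have hd : DifferentiableAt ℂ (fun y => fderiv ℂ ℓ y e) z :=
      (differentiableOn_fderiv_apply hW hℓ e).differentiableAt hev
    rw [hsec, hsec, hJ, hI, fderiv_fun_const_smul hd, map_smul, _root_.smul_apply,
      smul_smul, Complex.I_mul_I]
    simp

/-- Along the zero set of a holomorphic function `g` there are smooth cutoff functions that vanish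
near the zeros of `g`, tend to `1` elsewhere, and whose Dirichlet energies on compact sets tend
to `0`: convex functions of `log |g|` are plurisubharmonic, so that the Caccioppoli inequality
bounds the energies by `½ ∫ v² Δη`, which tends to `½ ∫ Δη = 0`. -/
theorem exists_cutoff_sequence {n : ℕ} {V : Set (Cn n)} (hV : IsOpen V) {g : Cn n → ℂ}
    (hg : DifferentiableOn ℂ g V) (hg1 : ∀ z ∈ V, ‖g z‖ ≤ 1)
    (hnull : volume {z | z ∈ V ∧ g z = 0} = 0) :
    ∃ v : ℕ → Cn n → ℝ, (∀ j, ContDiffOn ℝ (∞ : ℕ∞ω) (v j) V) ∧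
      (∀ j, ∀ z ∈ V, 0 ≤ v j z ∧ v j z ≤ 1) ∧
      (∀ j, ∀ z ∈ V, g z = 0 → v j =ᶠ[𝓝 z] 0) ∧
      (∀ z ∈ V, g z ≠ 0 → Tendsto (fun j => v j z) atTop (𝓝 1)) ∧
      ∀ η : Cn n → ℝ, ContDiff ℝ (∞ : ℕ∞ω) η → HasCompactSupport η → tsupport η ⊆ V →
        (∀ z, 0 ≤ η z) → ∀ e : Cn n,
        Tendsto (fun j => ∫ z, η z * (fderiv ℝ (v j) z e ^ 2 + fderiv ℝ (v j) z (J n e) ^ 2))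
          atTop (𝓝 0) := by
  obtain ⟨m, hm, hm0, hm01, hm1, hconv⟩ := exists_convex_profile
  let μ : ℕ → ℝ → ℝ := fun j s => m (1 + s / (j + 1))
  have hμ : ∀ j, ContDiff ℝ (∞ : ℕ∞ω) (μ j) := fun j => hm.comp (by fun_prop)
  have hμconv : ∀ j t, 0 ≤ deriv (deriv (μ j)) t := by
    intro j t
    have hin : ∀ s : ℝ, HasDerivAt (fun s : ℝ => 1 + s / ((j : ℝ) + 1)) (1 / ((j : ℝ) + 1)) s :=
      fun s => ((hasDerivAt_id s).div_const _).const_add 1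
    have hm' := (contDiff_infty_iff_deriv.1 hm).2
    have h1 : deriv (μ j) = fun s => deriv m (1 + s / (j + 1)) * (1 / ((j : ℝ) + 1)) := by
      funext s
      exact ((hm.differentiable (by simp) _).hasDerivAt.comp s (hin s)).deriv
    have h2 : deriv (deriv (μ j)) t =
        deriv (deriv m) (1 + t / (j + 1)) * (1 / ((j : ℝ) + 1)) * (1 / ((j : ℝ) + 1)) := by
      rw [h1]
      exact (((hm'.differentiable (by simp) _).hasDerivAt.comp t (hin t)).mul_const _).deriv
    rw [h2]
    have := hconv (1 + t / (j + 1))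
    positivity
  -- `log 0 = 0` in Mathlib, so the value on the zero set is prescribed separately.
  let v : ℕ → Cn n → ℝ := fun j z => if g z = 0 then 0 else μ j (Real.log ‖g z‖)
  have hcont : ∀ z ∈ V, ContinuousAt g z := fun z hz =>
    hg.continuousOn.continuousAt (hV.mem_nhds hz)
  have hzero : ∀ j, ∀ z ∈ V, g z = 0 → v j =ᶠ[𝓝 z] 0 := by
    intro j z hz hgz
    have h1 : ∀ᶠ y in 𝓝 z, ‖g y‖ < Real.exp (-(j + 1)) := by
      have := (hcont z hz).norm
      refine this.eventually (gt_mem_nhds ?_)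
      simp [hgz, Real.exp_pos]
    filter_upwards [h1] with y hy
    by_cases hy0 : g y = 0
    · simp [v, hy0]
    · have h2 : Real.log ‖g y‖ ≤ -(j + 1) := by
        rw [Real.log_le_iff_le_exp (by simpa using hy0)]
        exact hy.le
      have h3 : (0 : ℝ) < j + 1 := by positivity
      have h4 : 1 + Real.log ‖g y‖ / (j + 1) ≤ 0 := by
        have : Real.log ‖g y‖ / (j + 1) ≤ -1 := by
          rw [div_le_iff₀ h3]; linarith
        linarith
      simp only [v, if_neg hy0, μ, hm0 _ h4, Pi.zero_apply]
  have hne : ∀ j, ∀ z ∈ V, g z ≠ 0 → v j =ᶠ[𝓝 z] fun y => μ j (Real.log ‖g y‖) := by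
    intro j z hz hgz
    filter_upwards [(hcont z hz).eventually_ne hgz] with y hy
    simp [v, hy]
  have hsmooth : ∀ j, ContDiffOn ℝ (∞ : ℕ∞ω) (v j) V := by
    intro j z hz
    apply ContDiffAt.contDiffWithinAt
    by_cases hgz : g z = 0
    · exact (contDiffAt_const (c := (0 : ℝ))).congr_of_eventuallyEq (hzero j z hz hgz)
    · exact ((hμ j).contDiffAt.comp z (pluriharmonic_log_norm hV hg hz hgz).1).congr_of_eventuallyEq
        (hne j z hz hgz)
  have hrange : ∀ j, ∀ z ∈ V, 0 ≤ v j z ∧ v j z ≤ 1 := by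
    intro j z hz
    by_cases hgz : g z = 0
    · simp [v, hgz]
    · simp only [v, if_neg hgz]
      apply hm01
      have h1 : Real.log ‖g z‖ ≤ 0 := Real.log_nonpos (norm_nonneg _) (hg1 z hz)
      have h2 : Real.log ‖g z‖ / ((j : ℝ) + 1) ≤ 0 :=
        div_nonpos_of_nonpos_of_nonneg h1 (by positivity)
      linarith
  have hlim : ∀ z ∈ V, g z ≠ 0 → Tendsto (fun j => v j z) atTop (𝓝 1) := by
    intro z hz hgz
    simp only [v, if_neg hgz, μ]
    suffices h : Tendsto (fun j : ℕ => 1 + Real.log ‖g z‖ / ((j : ℝ) + 1)) atTop (𝓝 1) by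
      simpa only [hm1, Function.comp_def] using (hm.continuous.tendsto 1).comp h
    have : Tendsto (fun j : ℕ => Real.log ‖g z‖ / ((j : ℝ) + 1)) atTop (𝓝 0) :=
      tendsto_const_nhds.div_atTop (tendsto_atTop_add_const_right _ _ tendsto_natCast_atTop_atTop)
    simpa using this.const_add 1
  -- The cutoff functions are subharmonic on complex lines, and the first order term of the second
  -- derivative is the only one that survives, as `log ‖g‖` is harmonic there.
  have hsub : ∀ j e, ∀ z ∈ V,
      0 ≤ v j z * (secondDeriv e (v j) z + secondDeriv (J n e) (v j) z) := by
    intro j e z hz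
    by_cases hgz : g z = 0
    · simp [v, hgz]
    · refine mul_nonneg (hrange j z hz).1 ?_
      obtain ⟨h1, h2⟩ := pluriharmonic_log_norm hV hg hz hgz
      have h3 : ∀ a, secondDeriv a (v j) z = secondDeriv a (fun y => μ j (Real.log ‖g y‖)) z := by
        intro a
        have := (hne j z hz hgz).fderiv (𝕜 := ℝ)
        rw [secondDeriv, secondDeriv]
        congr 1
        refine Filter.EventuallyEq.fderiv_eq ?_
        filter_upwards [this] with y hy
        rw [hy]
      rw [h3, h3, secondDeriv_comp (hμ j) h1, secondDeriv_comp (hμ j) h1]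
      have h4 := hμconv j (Real.log ‖g z‖)
      have h5 : ∀ A B C D E F : ℝ, C + F = 0 →
          A * B ^ 2 + D * C + (A * E ^ 2 + D * F) = A * (B ^ 2 + E ^ 2) := by
        intro A B C D E F h
        linear_combination D * h
      rw [h5 _ _ _ _ _ _ (h2 e)]
      positivity
  refine ⟨v, hsmooth, hrange, hzero, hlim, ?_⟩
  intro η hη hc hηV hη0 e
  let L : Cn n → ℝ := fun z => secondDeriv e η z + secondDeriv (J n e) η z
  have hη1 : ∀ a, ContDiff ℝ (∞ : ℕ∞ω) fun z => fderiv ℝ η z a := fun a => by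
    rw [← contDiffOn_univ] at hη ⊢
    exact contDiffOn_fderiv_apply isOpen_univ hη a
  have hη2 : ∀ a, ContDiff ℝ (∞ : ℕ∞ω) (secondDeriv a η) := fun a => by
    have := hη1 a
    rw [← contDiffOn_univ] at this ⊢
    exact contDiffOn_fderiv_apply isOpen_univ this a
  have hsupp2 : ∀ a, HasCompactSupport (secondDeriv a η) := fun a =>
    (hc.fderiv_apply ℝ a).fderiv_apply ℝ a
  have hts2 : ∀ a, tsupport (secondDeriv a η) ⊆ tsupport η := fun a =>
    (tsupport_fderiv_apply_subset ℝ a).trans (tsupport_fderiv_apply_subset ℝ a)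
  have hsecint : ∀ a, Integrable (secondDeriv a η) := fun a =>
    (hη2 a).continuous.integrable_of_hasCompactSupport (hsupp2 a)
  have hLint : Integrable L := (hsecint e).add (hsecint (J n e))
  have hL0 : ∫ z, L z = 0 := by
    have h1 : ∀ a, ∫ z, secondDeriv a η z = 0 := by
      intro a
      have := integral_mul_secondDeriv (w := fun _ => 1) hV hη hc hηV contDiffOn_const a
      simpa [secondDeriv] using this.symm
    simp only [L]
    rw [integral_add (hsecint e) (hsecint (J n e)), h1, h1, add_zero]
  have hLV : ∀ z, z ∉ V → L z = 0 := by
    intro z hz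
    have h1 : ∀ a, secondDeriv a η z = 0 := fun a =>
      image_eq_zero_of_notMem_tsupport fun h => hz (hηV (hts2 a h))
    simp [L, h1]
  have hae : ∀ᵐ z : Cn n, ¬ (z ∈ V ∧ g z = 0) := by
    rw [ae_iff]; simpa using hnull
  have hvL : Tendsto (fun j => ∫ z, v j z ^ 2 * L z) atTop (𝓝 (∫ z, L z)) := by
    refine tendsto_integral_of_dominated_convergence (fun z => ‖L z‖) ?_ hLint.norm ?_ ?_
    · intro j
      have := (continuous_mul_of_tsupport_subset hV (f := fun z => v j z ^ 2)
        (hη2 e).continuous ((hts2 e).trans hηV) ((hsmooth j).continuousOn.pow 2)).add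
        (continuous_mul_of_tsupport_subset hV (f := fun z => v j z ^ 2)
        (hη2 (J n e)).continuous ((hts2 _).trans hηV) ((hsmooth j).continuousOn.pow 2))
      refine (this.congr fun z => ?_).aestronglyMeasurable
      simp only [L, Pi.add_apply]; ring
    · intro j
      refine Eventually.of_forall fun z => ?_
      by_cases hz : z ∈ V
      · obtain ⟨h1, h2⟩ := hrange j z hz
        rw [norm_mul]
        refine mul_le_of_le_one_left (norm_nonneg _) ?_
        rw [Real.norm_of_nonneg (by positivity)]
        exact pow_le_one₀ h1 h2
      · simp [hLV z hz]
    · filter_upwards [hae] with z hz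
      by_cases hzV : z ∈ V
      · have := ((hlim z hzV fun h => hz ⟨hzV, h⟩).pow 2).mul_const (L z)
        simpa using this
      · simp [hLV z hzV]
  rw [hL0] at hvL
  have hup : Tendsto (fun j => (1 / 2 : ℝ) * ∫ z, v j z ^ 2 * L z) atTop (𝓝 0) := by
    simpa only [mul_zero] using hvL.const_mul (1 / 2)
  refine squeeze_zero (fun j => integral_nonneg fun z => ?_) (fun j => ?_) hup
  · have := hη0 z
    positivity
  · exact integral_energy_le hV hη hc hηV hη0 (hsmooth j) e (hsub j e)

/-! ### Extension of weak solutions of the `∂̄`-equation across a zero set -/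

theorem exists_bilin_bound {G₁ G₂ G₃ : Type*} [NormedAddCommGroup G₁]
    [NormedSpace ℝ G₁] [NormedAddCommGroup G₂] [NormedSpace ℝ G₂] [NormedAddCommGroup G₃]
    [NormedSpace ℝ G₃] (B : G₁ →L[ℝ] G₂ →L[ℝ] G₃) :
    ∃ C : ℝ, 0 ≤ C ∧ ∀ a b, ‖B a b‖ ≤ C * ‖a‖ * ‖b‖ :=
  ⟨max ‖B‖ 0, le_max_right _ _, fun a b =>
    (B.le_opNorm₂ a b).trans (by gcongr; exact le_max_left _ _)⟩

/-- The pairing of a locally integrable function and a continuous function with compact support is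
integrable. -/
theorem integrable_bilin_of_tsupport_subset {n : ℕ} {G₁ G₂ G₃ : Type*} [NormedAddCommGroup G₁]
    [NormedSpace ℝ G₁] [NormedAddCommGroup G₂] [NormedSpace ℝ G₂] [NormedAddCommGroup G₃]
    [NormedSpace ℝ G₃] (B : G₁ →L[ℝ] G₂ →L[ℝ] G₃) {D : Set (Cn n)} {u : Cn n → G₁}
    (hu : LocallyIntegrableOn u D) {a : Cn n → G₂} (ha : Continuous a) (hc : HasCompactSupport a)
    (haD : tsupport a ⊆ D) : Integrable fun z => B (u z) (a z) := by
  have huK : IntegrableOn u (tsupport a) := hu.integrableOn_compact_subset haD hc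
  obtain ⟨M, hM⟩ := ha.bounded_above_of_compact_support hc
  have h1 : IntegrableOn (fun z => B (u z) (a z)) (tsupport a) := by
    refine Integrable.mono' (huK.norm.const_mul (‖B‖ * M)) ?_ ?_
    · exact B.aestronglyMeasurable_comp₂ huK.aestronglyMeasurable ha.aestronglyMeasurable
    · refine Eventually.of_forall fun z => (B.le_opNorm₂ _ _).trans ?_
      calc ‖B‖ * ‖u z‖ * ‖a z‖ ≤ ‖B‖ * ‖u z‖ * M := by gcongr; exact hM z
        _ = ‖B‖ * M * ‖u z‖ := by ring
  refine (integrableOn_iff_integrable_of_support_subset ?_).1 h1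
  intro z hz
  by_contra h
  exact hz (by simp [image_eq_zero_of_notMem_tsupport h])

/-- The pairing of a locally integrable function with the derivative of a test function is
integrable. -/
theorem integrable_bilin_fderiv {n : ℕ} {G₁ G₃ : Type*} [NormedAddCommGroup G₁]
    [NormedSpace ℝ G₁] [NormedAddCommGroup G₃] [NormedSpace ℝ G₃]
    (B : G₁ →L[ℝ] (Cn n →L[ℝ] ℂ) →L[ℝ] G₃) {D : Set (Cn n)} {u : Cn n → G₁}
    (hu : LocallyIntegrableOn u D) {φ : Cn n → ℂ} (hφ : ContDiff ℝ (∞ : ℕ∞ω) φ)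
    (hc : HasCompactSupport φ) (hφD : tsupport φ ⊆ D) :
    Integrable fun z => B (u z) (fderiv ℝ φ z) := by
  have h1 : Continuous (fderiv ℝ φ) := hφ.continuous_fderiv (by simp)
  have h2 : HasCompactSupport (fderiv ℝ φ) := hc.fderiv ℝ
  have h3 : tsupport (fderiv ℝ φ) ⊆ D := (tsupport_fderiv_subset ℝ).trans hφD
  exact integrable_bilin_of_tsupport_subset (G₂ := Cn n →L[ℝ] ℂ) B hu h1 h2 h3

/-- The norm of a real linear functional is bounded by its values on the standard basis. -/
theorem norm_sq_le_sum_sq {n : ℕ} (T : Cn n →L[ℝ] ℝ) :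
    ‖T‖ ^ 2 ≤ (2 * n) *
      ∑ i : Fin n, (T (Pi.single i 1) ^ 2 + T (J n (Pi.single i 1)) ^ 2) := by
  have hle : ‖T‖ ≤ ∑ i : Fin n, (|T (Pi.single i 1)| + |T (J n (Pi.single i 1))|) := by
    refine T.opNorm_le_bound (Finset.sum_nonneg fun i _ => by positivity) fun x => ?_
    have hx : x = ∑ i : Fin n, ((x i).re • (Pi.single i 1 : Cn n) +
        (x i).im • J n (Pi.single i 1)) := by
      have h1 : ∀ i : Fin n, ((x i).re • (Pi.single i 1 : Cn n) +
          (x i).im • J n (Pi.single i 1)) = Pi.single i (x i) := by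
        intro i
        have hJ : J n (Pi.single i 1) = Complex.I • (Pi.single i 1 : Cn n) := rfl
        rw [hJ]
        ext m
        by_cases h : m = i
        · subst h
          simp [Complex.re_add_im]
        · simp [h]
      simp only [h1]
      exact (Finset.univ_sum_single x).symm
    calc ‖T x‖ = ‖∑ i : Fin n, ((x i).re * T (Pi.single i 1) +
          (x i).im * T (J n (Pi.single i 1)))‖ := by
          conv_lhs => rw [hx]
          simp only [map_sum, map_add, map_smul, smul_eq_mul]
      _ ≤ ∑ i : Fin n, (|T (Pi.single i 1)| + |T (J n (Pi.single i 1))|) * ‖x‖ := by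
          refine norm_sum_le_of_le _ fun i _ => ?_
          have h1 : |(x i).re| ≤ ‖x‖ := (Complex.abs_re_le_norm _).trans (norm_le_pi_norm x i)
          have h2 : |(x i).im| ≤ ‖x‖ := (Complex.abs_im_le_norm _).trans (norm_le_pi_norm x i)
          rw [Real.norm_eq_abs]
          refine (abs_add_le _ _).trans ?_
          rw [abs_mul, abs_mul, add_mul, mul_comm |(x i).re|, mul_comm |(x i).im|]
          gcongr
      _ = _ := by rw [Finset.sum_mul]
  calc ‖T‖ ^ 2 ≤ (∑ i : Fin n, (|T (Pi.single i 1)| + |T (J n (Pi.single i 1))|)) ^ 2 := by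
        gcongr
    _ ≤ n * ∑ i : Fin n, (|T (Pi.single i 1)| + |T (J n (Pi.single i 1))|) ^ 2 := by
        simpa using sq_sum_le_card_mul_sum_sq (s := (Finset.univ : Finset (Fin n)))
          (f := fun i => |T (Pi.single i 1)| + |T (J n (Pi.single i 1))|)
    _ ≤ n * ∑ i : Fin n, 2 * (T (Pi.single i 1) ^ 2 + T (J n (Pi.single i 1)) ^ 2) := by
        gcongr with i
        refine add_sq_le.trans ?_
        simp [sq_abs]
    _ = _ := by rw [← Finset.mul_sum]; ring

/-- The Dirichlet energy in terms of the derivatives along the coordinate lines. -/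
theorem integral_mul_norm_fderiv_sq_le {n : ℕ} {V : Set (Cn n)} (hV : IsOpen V) {η v : Cn n → ℝ}
    (hη : Continuous η) (hc : HasCompactSupport η) (hηV : tsupport η ⊆ V) (hη0 : ∀ z, 0 ≤ η z)
    (hv : ContDiffOn ℝ (∞ : ℕ∞ω) v V) :
    ∫ z, η z * ‖fderiv ℝ v z‖ ^ 2 ≤ (2 * n : ℝ) * ∑ i : Fin n, ∫ z, η z *
      (fderiv ℝ v z (Pi.single i 1) ^ 2 + fderiv ℝ v z (J n (Pi.single i 1)) ^ 2) := by
  have hEint : ∀ i : Fin n, Integrable fun z => η z * (fderiv ℝ v z (Pi.single i 1) ^ 2 +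
      fderiv ℝ v z (J n (Pi.single i 1)) ^ 2) := fun i =>
    integrable_mul_of_tsupport_subset hV hη hc hηV
      (((contDiffOn_fderiv_apply hV hv _).continuousOn.pow 2).add
        ((contDiffOn_fderiv_apply hV hv _).continuousOn.pow 2))
  have hvV : ContinuousOn (fun z => ‖fderiv ℝ v z‖ ^ 2) V :=
    ((hv.continuousOn_fderiv_of_isOpen hV (by simp)).norm).pow 2
  rw [← integral_finsetSum _ fun i _ => hEint i, ← integral_const_mul]
  refine integral_mono (integrable_mul_of_tsupport_subset hV hη hc hηV hvV)
    ((integrable_finsetSum _ fun i _ => hEint i).const_mul _) fun z => ?_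
  have h3 := mul_le_mul_of_nonneg_left (norm_sq_le_sum_sq (fderiv ℝ v z)) (hη0 z)
  simp only [← Finset.mul_sum]
  linarith

set_option maxHeartbeats 400000 in
/-- The local form of the extension theorem: the equation is tested against `v_j χ`, where `v_j` are
the cutoff functions along the zeros of `g`. The error term `∫ χ ∂̄v_j ∧ u` tends to `0` by the
Cauchy–Schwarz inequality. -/
theorem weak_dbar_across_zeros {n : ℕ} {G₁ G₂ G₃ : Type*} [NormedAddCommGroup G₁] [NormedSpace ℝ G₁]
    [NormedAddCommGroup G₂] [NormedSpace ℝ G₂] [NormedAddCommGroup G₃] [NormedSpace ℝ G₃]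
    (P : G₂ →L[ℝ] ℂ →L[ℝ] G₃) (B : G₁ →L[ℝ] (Cn n →L[ℝ] ℂ) →L[ℝ] G₃) {V : Set (Cn n)} (hV : IsOpen V) (hVfin : volume V < ⊤)
    {g : Cn n → ℂ} (hg : DifferentiableOn ℂ g V) (hg1 : ∀ z ∈ V, ‖g z‖ ≤ 1)
    (hnull : volume {z | z ∈ V ∧ g z = 0} = 0)
    {u : Cn n → G₁} {F : Cn n → G₂}
    (hu : MemLp u 2 (volume.restrict V)) (hF : LocallyIntegrableOn F V)
    (heq : ∀ χ : Cn n → ℂ, ContDiff ℝ (∞ : ℕ∞ω) χ → HasCompactSupport χ →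
      tsupport χ ⊆ V \ {z | g z = 0} →
      ∫ z, P (F z) (χ z) = - ∫ z, B (u z) (fderiv ℝ χ z))
    {χ : Cn n → ℂ} (hχ : ContDiff ℝ (∞ : ℕ∞ω) χ) (hχc : HasCompactSupport χ)
    (hχV : tsupport χ ⊆ V) :
    ∫ z, P (F z) (χ z) = - ∫ z, B (u z) (fderiv ℝ χ z) := by
  obtain ⟨v, hvs, hv01, hv0, hv1, hvE⟩ := exists_cutoff_sequence hV hg hg1 hnull
  have : IsFiniteMeasure (volume.restrict V) := ⟨by simpa using hVfin⟩
  have huI : IntegrableOn u V := hu.integrable (by norm_num)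
  have huL : LocallyIntegrableOn u V := huI.locallyIntegrableOn
  let χj : ℕ → Cn n → ℂ := fun j z => v j z • χ z
  have hout : ∀ z ∉ V, ∀ᶠ y in 𝓝 z, χ y = 0 := by
    intro z hz
    filter_upwards [(isClosed_tsupport χ).isOpen_compl.mem_nhds fun h => hz (hχV h)] with y hy
    exact image_eq_zero_of_notMem_tsupport hy
  have hjs : ∀ j, ContDiff ℝ (∞ : ℕ∞ω) (χj j) := by
    intro j
    rw [contDiff_iff_contDiffAt]
    intro z
    by_cases hz : z ∈ V
    · exact ((hvs j).contDiffAt (hV.mem_nhds hz)).smul hχ.contDiffAt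
    · refine (contDiffAt_const (c := (0 : ℂ))).congr_of_eventuallyEq ?_
      filter_upwards [hout z hz] with y hy
      simp [χj, hy]
  have hjc : ∀ j, HasCompactSupport (χj j) := fun j =>
    hχc.mono fun z hz h => hz (by simp [χj, h])
  have hjsub : ∀ j, tsupport (χj j) ⊆ tsupport χ := fun j =>
    closure_mono fun z hz h => hz (by simp [χj, h])
  have hjV : ∀ j, tsupport (χj j) ⊆ V \ {z | g z = 0} := by
    intro j z hz
    have hzV := hχV (hjsub j hz)
    refine ⟨hzV, fun h0 => ?_⟩
    refine (notMem_tsupport_iff_eventuallyEq.2 ?_) hz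
    filter_upwards [hv0 j z hzV h0] with y hy
    simp [χj, hy]
  have hae : ∀ᵐ z : Cn n, ¬ (z ∈ V ∧ g z = 0) := by
    rw [ae_iff]; simpa using hnull
  -- The two terms that converge by dominated convergence.
  have hχF : Integrable fun z => P (F z) (χ z) := by
    exact integrable_bilin_of_tsupport_subset P hF hχ.continuous hχc hχV
  have hdc : Continuous fun z => fderiv ℝ χ z := hχ.continuous_fderiv (by simp)
  let w : Cn n → G₃ := fun z => B (u z) (fderiv ℝ χ z)
  have hwint : ∀ {φ : Cn n → ℂ}, ContDiff ℝ (∞ : ℕ∞ω) φ → HasCompactSupport φ →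
      tsupport φ ⊆ V → Integrable fun z => B (u z) (fderiv ℝ φ z) := by
    intro φ hφ hφc hφV
    exact integrable_bilin_fderiv B huL hφ hφc hφV
  have hw : Integrable w := hwint hχ hχc hχV
  have hwout : ∀ z ∉ V, w z = 0 := by
    intro z hz
    have : fderiv ℝ χ z = 0 := by
      rw [Filter.EventuallyEq.fderiv_eq (f := fun _ => (0 : ℂ)) (hout z hz)]
      simp
    simp only [w, this, map_zero]
  have hlim1 : Tendsto (fun j => ∫ z, P (F z) (χj j z)) atTop (𝓝 (∫ z, P (F z) (χ z))) := by
    refine tendsto_integral_of_dominated_convergence (fun z => ‖P (F z) (χ z)‖) ?_ hχF.norm ?_ ?_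
    · intro j
      exact (integrable_bilin_of_tsupport_subset P hF (hjs j).continuous (hjc j)
        ((hjsub j).trans hχV)).aestronglyMeasurable
    · intro j
      refine Eventually.of_forall fun z => ?_
      by_cases hz : z ∈ V
      · obtain ⟨h1, h2⟩ := hv01 j z hz
        simp only [χj, map_smul, norm_smul]
        refine mul_le_of_le_one_left (norm_nonneg _) ?_
        rwa [Real.norm_of_nonneg h1]
      · simp [χj, (hout z hz).self_of_nhds]
    · filter_upwards [hae] with z hz
      by_cases hzV : z ∈ V
      · have h1 := hv1 z hzV fun h => hz ⟨hzV, h⟩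
        simpa only [χj, map_smul, one_smul] using h1.smul_const (P (F z) (χ z))
      · simp [χj, (hout z hzV).self_of_nhds]
  have hvw_meas : ∀ j, AEStronglyMeasurable (fun z => v j z • w z) volume := by
    intro j
    have h1 : AEStronglyMeasurable (fun z => v j z • w z) (volume.restrict V) :=
      ((hvs j).continuousOn.aestronglyMeasurable hV.measurableSet).smul
        hw.aestronglyMeasurable.restrict
    rw [← aestronglyMeasurable_indicator_iff hV.measurableSet] at h1
    refine h1.congr (Eventually.of_forall fun z => ?_)
    by_cases hz : z ∈ V
    · simp [hz]
    · simp [hz, hwout z hz]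
  have hvw_le : ∀ j z, ‖v j z • w z‖ ≤ ‖w z‖ := by
    intro j z
    by_cases hz : z ∈ V
    · obtain ⟨h1, h2⟩ := hv01 j z hz
      rw [norm_smul]
      refine mul_le_of_le_one_left (norm_nonneg _) ?_
      rwa [Real.norm_of_nonneg h1]
    · simp [hwout z hz]
  have hlim2 : Tendsto (fun j => ∫ z, v j z • w z) atTop (𝓝 (∫ z, w z)) := by
    refine tendsto_integral_of_dominated_convergence (fun z => ‖w z‖) hvw_meas hw.norm
      (fun j => Eventually.of_forall (hvw_le j)) ?_
    filter_upwards [hae] with z hz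
    by_cases hzV : z ∈ V
    · simpa using (hv1 z hzV fun h => hz ⟨hzV, h⟩).smul_const (w z)
    · simp [hwout z hzV]
  -- The error term.
  let b : ℕ → Cn n → ℝ := fun j z => ‖χ z‖ * ‖fderiv ℝ (v j) z‖
  obtain ⟨C, hC0, hC⟩ := exists_bilin_bound B
  let T : ℕ → Cn n → G₃ := fun j z =>
    B (u z) (fderiv ℝ (χj j) z) - v j z • w z
  have hT : ∀ j z, ‖T j z‖ ≤ C * (‖u z‖ * b j z) := by
    intro j z
    by_cases hz : z ∈ V
    · have hvd : HasFDerivAt (v j) (fderiv ℝ (v j) z) z :=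
        (((hvs j).contDiffAt (hV.mem_nhds hz)).differentiableAt (by simp)).hasFDerivAt
      have hχd : HasFDerivAt χ (fderiv ℝ χ z) z := (hχ.differentiable (by simp) z).hasFDerivAt
      have h1 : fderiv ℝ (χj j) z = v j z • fderiv ℝ χ z + (fderiv ℝ (v j) z).smulRight (χ z) :=
        (hvd.smul hχd).fderiv
      have h2 : T j z = B (u z) ((fderiv ℝ (v j) z).smulRight (χ z)) := by
        simp only [T, w]
        rw [h1, map_add, map_smul, add_sub_cancel_left]
      rw [h2]
      calc _ ≤ C * ‖u z‖ * ‖(fderiv ℝ (v j) z).smulRight (χ z)‖ := hC _ _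
        _ ≤ C * ‖u z‖ * (‖χ z‖ * ‖fderiv ℝ (v j) z‖) := by
            gcongr
            rw [ContinuousLinearMap.norm_smulRight_apply, mul_comm]
        _ = _ := by simp only [b]; ring
    · have h0 : χj j =ᶠ[𝓝 z] fun _ => 0 := by
        filter_upwards [hout z hz] with y hy
        simp [χj, hy]
      have : fderiv ℝ (χj j) z = 0 := by rw [h0.fderiv_eq]; simp
      have h3 : T j z = 0 := by
        simp only [T, hwout z hz, this, map_zero, smul_zero, sub_zero]
      rw [h3, norm_zero]
      positivity
  have hbV : ∀ j, ContinuousOn (fun z => ‖fderiv ℝ (v j) z‖) V := fun j =>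
    ((hvs j).continuousOn_fderiv_of_isOpen hV (by simp)).norm
  have hbc : ∀ j, Continuous (b j) := by
    intro j
    have hs : Function.support (fun z => ‖χ z‖) ⊆ Function.support χ :=
      fun z hz h => hz (by simp [h])
    exact continuous_mul_of_tsupport_subset hV hχ.continuous.norm ((closure_mono hs).trans hχV)
      (hbV j)
  have hbcs : ∀ j, HasCompactSupport (b j) := fun j => hχc.norm.mul_right
  let η : Cn n → ℝ := fun z => ‖χ z‖ ^ 2
  have hη : ContDiff ℝ (∞ : ℕ∞ω) η := hχ.norm_sq ℝ
  have hηs : Function.support η ⊆ Function.support χ := fun z hz h => hz (by simp [η, h])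
  have hηc : HasCompactSupport η := hχc.mono hηs
  have hηV : tsupport η ⊆ V := (closure_mono hηs).trans hχV
  have hblim : Tendsto (fun j => ∫ z, b j z ^ 2) atTop (𝓝 0) := by
    let E : ℕ → Fin n → ℝ := fun j i => ∫ z, η z * (fderiv ℝ (v j) z (Pi.single i 1) ^ 2 +
      fderiv ℝ (v j) z (J n (Pi.single i 1)) ^ 2)
    have h1 : Tendsto (fun j => (2 * n : ℝ) * ∑ i, E j i) atTop (𝓝 0) := by
      have := (tendsto_finsetSum (Finset.univ : Finset (Fin n)) fun i _ =>
        hvE η hη hηc hηV (fun z => by positivity) (Pi.single i 1)).const_mul (2 * n : ℝ)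
      simpa using this
    refine squeeze_zero (fun j => integral_nonneg fun z => by positivity) (fun j => ?_) h1
    have h2 := integral_mul_norm_fderiv_sq_le hV hη.continuous hηc hηV (fun z => by positivity)
      (hvs j)
    simpa only [b, η, mul_pow] using h2
  have hTlim : Tendsto (fun j => ∫ z, T j z) atTop (𝓝 0) := by
    rw [tendsto_zero_iff_norm_tendsto_zero]
    have h2 : Tendsto (fun j => C * ((∫ z in V, ‖u z‖ ^ (2 : ℝ)) ^ (1 / 2 : ℝ) *
        (∫ z, b j z ^ 2) ^ (1 / 2 : ℝ))) atTop (𝓝 0) := by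
      have := ((hblim.rpow_const (p := (1 / 2 : ℝ)) (Or.inr (by norm_num))).const_mul
        ((∫ z in V, ‖u z‖ ^ (2 : ℝ)) ^ (1 / 2 : ℝ))).const_mul C
      simpa using this
    refine squeeze_zero (fun j => norm_nonneg _) (fun j => ?_) h2
    have hbL : MemLp (b j) (ENNReal.ofReal 2) (volume.restrict V) :=
      ((hbc j).memLp_of_hasCompactSupport (hbcs j)).restrict V
    have huL2 : MemLp u (ENNReal.ofReal 2) (volume.restrict V) := by simpa using hu
    have hb0 : ∀ z, 0 ≤ b j z := fun z => by positivity
    have hCS := integral_mul_norm_le_Lp_mul_Lq (μ := volume.restrict V)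
      (f := fun z => ‖u z‖) (g := b j) Real.HolderConjugate.two_two huL2.norm hbL
    simp only [norm_norm] at hCS
    have hub : IntegrableOn (fun z => ‖u z‖ * b j z) V := by
      obtain ⟨M, hM⟩ := (hbc j).bounded_above_of_compact_support (hbcs j)
      exact huI.norm.mul_bdd (hbc j).aestronglyMeasurable (Eventually.of_forall hM)
    have hboutV : ∀ z ∉ V, b j z = 0 := fun z hz => by simp [b, (hout z hz).self_of_nhds]
    calc ‖∫ z, T j z‖ = ‖∫ z in V, T j z‖ := by
          rw [setIntegral_eq_integral_of_forall_compl_eq_zero]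
          intro z hz
          have := hT j z
          rw [hboutV z hz, mul_zero, mul_zero] at this
          exact norm_le_zero_iff.1 this
      _ ≤ ∫ z in V, C * (‖u z‖ * b j z) :=
          norm_integral_le_of_norm_le (hub.const_mul C) (Eventually.of_forall (hT j))
      _ = C * ∫ z in V, ‖u z‖ * ‖b j z‖ := by
          rw [integral_const_mul]
          simp only [Real.norm_of_nonneg (hb0 _)]
      _ ≤ C * ((∫ z in V, ‖u z‖ ^ (2 : ℝ)) ^ (1 / 2 : ℝ) *
          (∫ z in V, ‖b j z‖ ^ (2 : ℝ)) ^ (1 / 2 : ℝ)) := by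
          gcongr
      _ = _ := by
          congr 3
          rw [setIntegral_eq_integral_of_forall_compl_eq_zero]
          · simp
          · intro z hz
            simp [hboutV z hz]
  have hfinal : ∀ j, ∫ z, P (F z) (χj j z) = - ((∫ z, v j z • w z) + ∫ z, T j z) := by
    intro j
    rw [heq (χj j) (hjs j) (hjc j) (hjV j)]
    have hvwI : Integrable fun z => v j z • w z :=
      hw.mono (hvw_meas j) (Eventually.of_forall (hvw_le j))
    have hI := hwint (hjs j) (hjc j) ((hjsub j).trans hχV)
    have h1 : ∫ z, T j z = _ := integral_sub hI hvwI
    rw [h1, add_sub_cancel]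
  have hlim3 := (hlim2.add hTlim).neg
  rw [add_zero] at hlim3
  exact tendsto_nhds_unique hlim1 (by simpa only [hfinal] using hlim3)

/-- A solution in `L²_loc` of the `∂̄`-equation off a set `A` which is locally contained in the zero
set of a non-trivial holomorphic function is a solution across `A`. -/
theorem weak_dbar_extend {n : ℕ} {G₁ G₂ G₃ : Type*} [NormedAddCommGroup G₁] [NormedSpace ℝ G₁]
    [NormedAddCommGroup G₂] [NormedSpace ℝ G₂] [NormedAddCommGroup G₃] [NormedSpace ℝ G₃]
    (P : G₂ →L[ℝ] ℂ →L[ℝ] G₃) (B : G₁ →L[ℝ] (Cn n →L[ℝ] ℂ) →L[ℝ] G₃) {D A : Set (Cn n)}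
    (hthin : ∀ z ∈ D, ∃ V : Set (Cn n), IsOpen V ∧ z ∈ V ∧ V ⊆ D ∧ ∃ g : Cn n → ℂ,
      DifferentiableOn ℂ g V ∧ A ∩ V ⊆ {y | g y = 0} ∧ volume {y | y ∈ V ∧ g y = 0} = 0)
    {u : Cn n → G₁} {F : Cn n → G₂}
    (hu : ∀ z ∈ D, ∃ V ∈ 𝓝 z, MemLp u 2 (volume.restrict V))
    (huI : LocallyIntegrableOn u D) (hF : LocallyIntegrableOn F D)
    (heq : ∀ χ : Cn n → ℂ, ContDiff ℝ (∞ : ℕ∞ω) χ → HasCompactSupport χ → tsupport χ ⊆ D \ A →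
      ∫ z, P (F z) (χ z) = - ∫ z, B (u z) (fderiv ℝ χ z))
    {χ : Cn n → ℂ} (hχ : ContDiff ℝ (∞ : ℕ∞ω) χ) (hχc : HasCompactSupport χ)
    (hχD : tsupport χ ⊆ D) :
    ∫ z, P (F z) (χ z) = - ∫ z, B (u z) (fderiv ℝ χ z) := by
  have hloc : ∀ z ∈ D, ∃ V : Set (Cn n), IsOpen V ∧ z ∈ V ∧ V ⊆ D ∧
      ∀ φ : Cn n → ℂ, ContDiff ℝ (∞ : ℕ∞ω) φ → HasCompactSupport φ → tsupport φ ⊆ V →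
        ∫ z, P (F z) (φ z) = - ∫ z, B (u z) (fderiv ℝ φ z) := by
    intro z hz
    obtain ⟨V, hV, hzV, hVD, g, hg, hgA, hgnull⟩ := hthin z hz
    obtain ⟨V', hV', hu'⟩ := hu z hz
    -- Shrink the neighborhood so that `g` is bounded, and rescale `g`.
    have hgc : ContinuousAt g z := hg.continuousOn.continuousAt (hV.mem_nhds hzV)
    have hb : ∀ᶠ y in 𝓝 z, ‖g y‖ < ‖g z‖ + 1 :=
      hgc.norm.eventually (gt_mem_nhds (lt_add_one _))
    obtain ⟨ε, hε, hεsub⟩ := Metric.mem_nhds_iff.1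
      (inter_mem (inter_mem (hV.mem_nhds hzV) hV') hb)
    let c : ℂ := ((‖g z‖ + 1 : ℝ) : ℂ)⁻¹
    have hcpos : (0 : ℝ) < ‖g z‖ + 1 := by positivity
    have hc0 : c ≠ 0 := inv_ne_zero (by exact_mod_cast hcpos.ne')
    have hB : Metric.ball z ε ⊆ V := fun y hy => (hεsub hy).1.1
    refine ⟨Metric.ball z ε, Metric.isOpen_ball, Metric.mem_ball_self hε, hB.trans hVD, ?_⟩
    intro φ hφ hφc hφV
    refine weak_dbar_across_zeros P B Metric.isOpen_ball measure_ball_lt_top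
      (g := fun y => c * g y) ((hg.mono hB).const_mul c) ?_ ?_
      (hu'.mono_measure (Measure.restrict_mono (fun y hy => (hεsub hy).1.2) le_rfl))
      (hF.mono_set (hB.trans hVD)) ?_ hφ hφc hφV
    · intro y hy
      have h1 : ‖g y‖ < ‖g z‖ + 1 := (hεsub hy).2
      rw [norm_mul, norm_inv, Complex.norm_real, Real.norm_of_nonneg hcpos.le,
        inv_mul_le_iff₀ hcpos, mul_one]
      exact h1.le
    · refine measure_mono_null ?_ hgnull
      rintro y ⟨hy, h0⟩
      exact ⟨hB hy, (mul_eq_zero.1 h0).resolve_left hc0⟩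
    · intro ψ hψ hψc hψV
      refine heq ψ hψ hψc fun y hy => ?_
      obtain ⟨h1, h2⟩ := hψV hy
      refine ⟨hVD (hB h1), fun hA => h2 ?_⟩
      have : g y = 0 := hgA ⟨hA, hB h1⟩
      simp [this]
  choose! V hVo hzV hVD hVeq using hloc
  -- A smooth partition of unity reduces the claim to the local one.
  obtain ⟨t, ht, htcov⟩ := hχc.isCompact.elim_nhds_subcover V
    fun z hz => (hVo z (hχD hz)).mem_nhds (hzV z (hχD hz))
  obtain ⟨ρ, hρ⟩ := SmoothPartitionOfUnity.exists_isSubordinate 𝓘(ℝ, Cn n)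
    (isClosed_tsupport χ) (fun i : t => V i) (fun i => hVo i (hχD (ht i i.2)))
    (fun z hz => by
      obtain ⟨i, hi, hzi⟩ := mem_iUnion₂.1 (htcov hz)
      exact mem_iUnion.2 ⟨⟨i, hi⟩, hzi⟩)
  let χi : t → Cn n → ℂ := fun i z => ρ i z • χ z
  have hi : ∀ i, ContDiff ℝ (∞ : ℕ∞ω) (χi i) := fun i => (ρ i).contMDiff.contDiff.smul hχ
  have hic : ∀ i, HasCompactSupport (χi i) := fun i =>
    hχc.mono fun z (hz : χi i z ≠ 0) (h : χ z = 0) => hz (by simp [χi, h])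
  have hiV : ∀ i : t, tsupport (χi i) ⊆ V i := fun i =>
    (tsupport_smul_subset_left (ρ i) χ).trans (hρ i)
  have hiD : ∀ i : t, tsupport (χi i) ⊆ D := fun i => (hiV i).trans (hVD i (hχD (ht i i.2)))
  have hsum : χ = fun z => ∑ i, χi i z := by
    funext z
    by_cases hz : z ∈ tsupport χ
    · have h1 := ρ.sum_eq_one hz
      rw [finsum_eq_sum_of_fintype] at h1
      simp only [χi, ← Finset.sum_smul, h1, one_smul]
    · simp [χi, image_eq_zero_of_notMem_tsupport hz]
  have hdsum : ∀ z, B (u z) (fderiv ℝ χ z) =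
      ∑ i, B (u z) (fderiv ℝ (χi i) z) := by
    intro z
    have h1 : fderiv ℝ χ z = ∑ i, fderiv ℝ (χi i) z := by
      conv_lhs => rw [hsum]
      exact fderiv_fun_sum fun i _ => (hi i).differentiable (by simp) z
    rw [h1]
    simp only [map_sum]
  have hI1 : ∀ i, Integrable fun z => P (F z) (χi i z) := by
    intro i
    exact integrable_bilin_of_tsupport_subset P hF (hi i).continuous (hic i) (hiD i)
  have hI2 : ∀ i, Integrable fun z => B (u z) (fderiv ℝ (χi i) z) := by
    intro i
    exact integrable_bilin_fderiv B huI (hi i) (hic i) (hiD i)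
  have e1 : ∫ z, P (F z) (χ z) = ∑ i, ∫ z, P (F z) (χi i z) := by
    rw [← integral_finsetSum _ fun i _ => hI1 i]
    congr 1
    funext z
    rw [← map_sum]
    congr 1
    exact congrFun hsum z
  have e2 : ∫ z, B (u z) (fderiv ℝ χ z) =
      ∑ i, ∫ z, B (u z) (fderiv ℝ (χi i) z) := by
    rw [← integral_finsetSum _ fun i _ => hI2 i]
    simp only [hdsum]
  rw [e1, e2, ← Finset.sum_neg_distrib]
  exact Finset.sum_congr rfl fun i _ => hVeq i (hχD (ht i i.2)) _ (hi i) (hic i) (hiV i)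

/-- The operator `η ↦ ∂̄`-part of `η`, wedged with a form, as a continuous bilinear map. -/
theorem exists_bilin_wedge_conjPart (n k r : ℕ) :
    ∃ B : Form n k (Cn r) →L[ℝ] (Cn n →L[ℝ] ℂ) →L[ℝ] Form n (k + 1) (Cn r),
      ∀ α T, B α T = wedgeOne α (conjPart T) := by
  let W : Form n k (Cn r) →L[ℝ] (Cn n →L[ℝ] ℂ) →L[ℝ] Form n (k + 1) (Cn r) :=
    (ContinuousLinearMap.compL ℝ (Cn n →L[ℝ] ℂ) (Cn n →L[ℝ] Form n k (Cn r))
      (Form n (k + 1) (Cn r))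
      (ContinuousAlternatingMap.alternatizeUncurryFinCLM ℝ (Cn n) (Cn r))) ∘L
    (ContinuousLinearMap.compL ℝ (Cn n) ℂ (Form n k (Cn r))) ∘L
      (ContinuousLinearMap.lsmul ℝ ℂ : ℂ →L[ℝ] Form n k (Cn r) →L[ℝ] Form n k (Cn r)).flip
  let C : (Cn n →L[ℝ] ℂ) →ₗ[ℝ] (Cn n →L[ℝ] ℂ) :=
    { toFun := conjPart
      map_add' := fun S T => by
        ext v; simp [conjPart]; ring
      map_smul' := fun c T => by
        ext v; simp [conjPart]; ring }
  exact ⟨W.bilinearComp (ContinuousLinearMap.id ℝ _) (LinearMap.toContinuousLinearMap C),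
    fun α T => rfl⟩

/-- Scalar multiplication of forms, as a continuous bilinear map. -/
theorem exists_bilin_smul (n k r : ℕ) :
    ∃ P : Form n k (Cn r) →L[ℝ] ℂ →L[ℝ] Form n k (Cn r), ∀ F c, P F c = c • F :=
  ⟨(ContinuousLinearMap.lsmul ℝ ℂ : ℂ →L[ℝ] Form n k (Cn r) →L[ℝ] Form n k (Cn r)).flip,
    fun _ _ => rfl⟩

/-! ### The metric of a positive form -/

/-- The Riemannian metric `g(v, w) = κ(v, J w)` of a positive `(1,1)`-form `κ`. -/
def metricForm {n : ℕ} (κ : Form n 2 ℝ) : LinearMap.BilinForm ℝ (Cn n) :=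
  LinearMap.mk₂ ℝ (fun v w => κ ![v, J n w])
    (fun v v' w => by
      change κ.curryLeft (v + v') ![J n w] = _
      rw [map_add]; rfl)
    (fun c v w => by
      change κ.curryLeft (c • v) ![J n w] = _
      rw [map_smul]; rfl)
    (fun v w w' => by
      change (κ.curryLeft v).curryLeft (J n (w + w')) ![] = _
      rw [map_add, map_add]; rfl)
    (fun c v w => by
      change (κ.curryLeft v).curryLeft (J n (c • w)) ![] = _
      rw [map_smul, map_smul]; rfl)

theorem metricForm_apply {n : ℕ} (κ : Form n 2 ℝ) (v w : Cn n) :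
    metricForm κ v w = κ ![v, J n w] := rfl

theorem J_J {n : ℕ} (v : Cn n) : J n (J n v) = -v := by
  change Complex.I • (Complex.I • v) = -v
  rw [smul_smul, Complex.I_mul_I, neg_one_smul]

theorem metricForm_symm {n : ℕ} {κ : Form n 2 ℝ}
    (hκ : ∀ v w : Cn n, κ ![J n v, J n w] = κ ![v, w]) (v w : Cn n) :
    metricForm κ v w = metricForm κ w v := by
  have hswap : ∀ a b : Cn n, κ ![a, b] = -κ ![b, a] := by
    intro a b
    have h := κ.map_swap ![b, a] (i := 0) (j := 1) (by decide)
    have h1 : κ ![a, b] = κ.toAlternatingMap (![b, a] ∘ Equiv.swap 0 1) := by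
      change κ.toAlternatingMap _ = _
      congr 1
      ext i; fin_cases i <;> rfl
    rw [h1, h]
    rfl
  have hneg : ∀ a b : Cn n, κ ![a, -b] = -κ ![a, b] := by
    intro a b
    change (κ.curryLeft a).curryLeft (-b) ![] = _
    rw [map_neg]; rfl
  rw [metricForm_apply, metricForm_apply, ← hκ v (J n w), J_J, hneg, hswap, neg_neg]

/-- A positive `(1,1)`-form has an orthonormal basis. -/
theorem isOrthonormalFor_onb {n : ℕ} {κ : Form n 2 ℝ}
    (hκ : ∀ v w : Cn n, κ ![J n v, J n w] = κ ![v, w])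
    (hpos : ∀ v : Cn n, v ≠ 0 → 0 < κ ![v, J n v]) : IsOrthonormalFor κ (onb κ) := by
  apply Classical.epsilon_spec
  have hsymm : LinearMap.IsSymm (metricForm κ) := ⟨fun v w => metricForm_symm hκ v w⟩
  have : Invertible (2 : ℝ) := invertibleOfNonzero two_ne_zero
  obtain ⟨b, hb⟩ := LinearMap.BilinForm.exists_orthogonal_basis hsymm
  have hcard : Module.finrank ℝ (Cn n) = Fintype.card (Fin n × Fin 2) := by
    rw [Module.finrank_pi_fintype]
    simp [Complex.finrank_real_complex]
  let σ : Fin n × Fin 2 ≃ Fin (Module.finrank ℝ (Cn n)) :=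
    Fintype.equivFinOfCardEq hcard.symm
  let N : Fin n × Fin 2 → ℝ := fun i => metricForm κ (b (σ i)) (b (σ i))
  have hN : ∀ i, 0 < N i := fun i => hpos _ (b.ne_zero _)
  refine ⟨fun i => (Real.sqrt (N i))⁻¹ • b (σ i), fun i j => ?_⟩
  change metricForm κ ((Real.sqrt (N i))⁻¹ • b (σ i)) ((Real.sqrt (N j))⁻¹ • b (σ j)) = _
  rw [map_smul, map_smul, LinearMap.smul_apply, smul_eq_mul, smul_eq_mul]
  by_cases h : i = j
  · subst h
    rw [if_pos rfl]
    have h1 : Real.sqrt (N i) ≠ 0 := (Real.sqrt_pos.2 (hN i)).ne'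
    have h2 : metricForm κ (b (σ i)) (b (σ i)) = Real.sqrt (N i) * Real.sqrt (N i) :=
      (Real.mul_self_sqrt (hN i).le).symm
    rw [h2]
    field_simp
  · have h1 : metricForm κ (b (σ i)) (b (σ j)) = 0 := hb fun hij => h (σ.injective hij)
    rw [h1, if_neg h]
    simp

/-- Bessel's inequality for a single coordinate. -/
theorem IsOrthonormalFor.sq_coeff_le {n : ℕ} {κ : Form n 2 ℝ} {e : Fin n × Fin 2 → Cn n}
    (he : IsOrthonormalFor κ e) (v : Cn n) (l : Fin n × Fin 2) : κ ![v, J n (e l)] ^ 2 ≤ κ ![v, J n v] := by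
  have h1 : metricForm κ v v = ∑ l, metricForm κ v (e l) ^ 2 := by
    calc metricForm κ v v = metricForm κ v (∑ l, κ ![v, J n (e l)] • e l) := by rw [he.sum_eq v]
      _ = ∑ l, metricForm κ v (e l) ^ 2 := by
        rw [map_sum]
        refine Finset.sum_congr rfl fun m _ => ?_
        rw [map_smul, smul_eq_mul, sq]
        rfl
  have h2 : metricForm κ v (e l) ^ 2 ≤ ∑ l, metricForm κ v (e l) ^ 2 :=
    Finset.single_le_sum (f := fun l => metricForm κ v (e l) ^ 2) (fun i _ => sq_nonneg _)
      (Finset.mem_univ l)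
  exact h2.trans h1.ge

/-- A form is bounded by its values on an orthonormal basis. -/
theorem IsOrthonormalFor.norm_apply_le {n k r : ℕ} {κ : Form n 2 ℝ} {e : Fin n × Fin 2 → Cn n}
    (he : IsOrthonormalFor κ e)
    (α : Form n k (Cn r)) (v : Fin k → Cn n) (M : Fin k → ℝ) (hM0 : ∀ m, 0 ≤ M m)
    (hM : ∀ m, κ ![v m, J n (v m)] ≤ M m ^ 2) :
    ‖α v‖ ≤ (∏ m, M m) * ∑ i : Fin k → Fin n × Fin 2, ‖α (e ∘ i)‖ := by
  have h1 : v = fun m => ∑ l, κ ![v m, J n (e l)] • e l := funext fun m => (he.sum_eq (v m)).symm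
  have h2 : α v = ∑ i : Fin k → Fin n × Fin 2,
      (∏ m, κ ![v m, J n (e (i m))]) • α (e ∘ i) := by
    conv_lhs => rw [h1]
    change α.toMultilinearMap _ = _
    rw [MultilinearMap.map_sum]
    refine Finset.sum_congr rfl fun i _ => ?_
    rw [MultilinearMap.map_smul_univ]
    rfl
  rw [h2, Finset.mul_sum]
  refine norm_sum_le_of_le _ fun i _ => ?_
  rw [norm_smul, norm_prod]
  gcongr with m
  exact abs_le_of_sq_le_sq ((he.sq_coeff_le (v m) (i m)).trans (hM m)) (hM0 m)

/-- The squared length of a vector for the Hermitian form obtained by polarization. -/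
theorem re_polar_self {r : ℕ} {N : Cn r → ℝ≥0∞} (hN : ∀ (c : ℂ) a, N (c • a) = ‖c‖ₑ * N a)
    (a : Cn r) : (polar N a a).re = (N a ^ 2).toReal := by
  have h0 : N (a - a) = 0 := by
    have := hN 0 (a - a)
    simpa using this
  have h2 : N (a + a) = 2 * N a := by
    have := hN 2 a
    rw [two_smul] at this
    rw [this]
    congr 1
    rw [← ofReal_norm]; simp
  have h3 : ∀ x y : ℝ, ((1 / 4 : ℂ) * ((x : ℂ) + Complex.I * (y : ℂ))).re = x / 4 := by
    intro x y
    rw [show (1 / 4 : ℂ) = ((1 / 4 : ℝ) : ℂ) by push_cast; norm_num, Complex.re_ofReal_mul]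
    simp
    ring
  rw [polar, h3, h0, h2, mul_pow, ENNReal.toReal_mul]
  norm_num

/-- Where the metric dominates a multiple of the standard one, the length of a form dominates a
multiple of its values on the basis. -/
theorem sum_norm_sq_le_formInner {n k r : ℕ} {e : Fin n × Fin 2 → Cn n} {N : Cn r → ℝ≥0∞}
    (hN : ∀ (c : ℂ) a, N (c • a) = ‖c‖ₑ * N a) (hfin : ∀ a, N a ≠ ⊤) {C : ℝ} (hC : 0 ≤ C)
    (hle : ∀ a, ‖a‖ₑ ≤ ENNReal.ofReal C * N a) (α : Form n k (Cn r)) :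
    ∑ i : Fin k → Fin n × Fin 2, ‖α (e ∘ i)‖ ^ 2 ≤
      (k.factorial : ℝ) * C ^ 2 * (formInner e (polar N) α α).re := by
  have h1 : (formInner e (polar N) α α).re =
      (k.factorial : ℝ)⁻¹ * ∑ i : Fin k → Fin n × Fin 2, (N (α (e ∘ i)) ^ 2).toReal := by
    have : ((k.factorial : ℂ))⁻¹ = (((k.factorial : ℝ)⁻¹ : ℝ) : ℂ) := by push_cast; rfl
    rw [formInner, this, Complex.re_ofReal_mul, Complex.re_sum]
    simp only [re_polar_self hN]
  have hk : (k.factorial : ℝ) ≠ 0 := by exact_mod_cast k.factorial_ne_zero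
  have h2 : (k.factorial : ℝ) * C ^ 2 * (formInner e (polar N) α α).re =
      ∑ i : Fin k → Fin n × Fin 2, C ^ 2 * (N (α (e ∘ i)) ^ 2).toReal := by
    rw [h1, ← Finset.mul_sum]
    field_simp
  rw [h2]
  refine Finset.sum_le_sum fun i _ => ?_
  have h3 : ‖α (e ∘ i)‖ ≤ C * (N (α (e ∘ i))).toReal := by
    have := ENNReal.toReal_mono (ENNReal.mul_ne_top ENNReal.ofReal_ne_top (hfin _))
      (hle (α (e ∘ i)))
    rwa [toReal_enorm, ENNReal.toReal_mul, ENNReal.toReal_ofReal hC] at this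
  rw [ENNReal.toReal_pow, ← mul_pow]
  gcongr

/-! ### Kähler forms in a chart -/

section Chart

variable {n : ℕ} {X : Type*} [TopologicalSpace X] [ChartedSpace (Cn n) X]

theorem chartDeriv_J (c : X) (z v : Cn n) :
    chartDeriv c z (J n v) = J n (chartDeriv c z v) := by
  let D : Cn n →L[ℂ] Cn n := mfderiv 𝓘(ℂ, Cn n) 𝓘(ℂ, Cn n) (chartAt (Cn n) c).symm z
  change D (Complex.I • v) = Complex.I • D v
  rw [map_smul]

theorem pull_metric_apply (κ : X → Form n 2 ℝ) (c : X) (z v w : Cn n) :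
    pull c κ z ![v, J n w] = κ ((chartAt (Cn n) c).symm z)
      ![chartDeriv c z v, J n (chartDeriv c z w)] := by
  rw [← chartDeriv_J]
  change κ _ (chartDeriv c z ∘ ![v, J n w]) = _
  congr 1
  ext i; fin_cases i <;> rfl

theorem norm_J_le (v : Cn n) : ‖J n v‖ ≤ ‖v‖ := by
  change ‖Complex.I • v‖ ≤ ‖v‖
  rw [norm_smul]; simp

/-- In a chart, a form is bounded by its values on an orthonormal basis, with a constant that
depends only on the size of the Kähler form in the chart. -/
theorem norm_pull_le {k r : ℕ} {κ : X → Form n 2 ℝ} (c : X) (z : Cn n)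
    (hκ : ∀ v w : Cn n, κ ((chartAt (Cn n) c).symm z) ![J n v, J n w] =
      κ ((chartAt (Cn n) c).symm z) ![v, w])
    (hpos : ∀ v : Cn n, v ≠ 0 → 0 < κ ((chartAt (Cn n) c).symm z) ![v, J n v])
    {M : ℝ} (hM0 : 0 ≤ M) (hM : ‖pull c κ z‖ ≤ M ^ 2) (α : X → Form n k (Cn r)) :
    ‖pull c α z‖ ≤ M ^ k * ∑ i : Fin k → Fin n × Fin 2,
      ‖α ((chartAt (Cn n) c).symm z) (onb (κ ((chartAt (Cn n) c).symm z)) ∘ i)‖ := by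
  refine ContinuousAlternatingMap.opNorm_le_bound _ (by positivity) fun v => ?_
  have h1 := (isOrthonormalFor_onb hκ hpos).norm_apply_le (α ((chartAt (Cn n) c).symm z))
    (fun m => chartDeriv c z (v m)) (fun m => M * ‖v m‖) (fun m => by positivity) (fun m => by
      rw [← pull_metric_apply]
      refine (le_abs_self _).trans (((pull c κ z).le_opNorm _).trans ?_)
      rw [Fin.prod_univ_two, mul_pow]
      simp only [Matrix.cons_val_zero, Matrix.cons_val_one]
      calc ‖pull c κ z‖ * (‖v m‖ * ‖J n (v m)‖) ≤ M ^ 2 * (‖v m‖ * ‖v m‖) := by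
            gcongr
            exact norm_J_le _
        _ = M ^ 2 * ‖v m‖ ^ 2 := by ring)
  refine h1.trans (le_of_eq ?_)
  rw [Finset.prod_mul_distrib, Finset.prod_const, Finset.card_univ, Fintype.card_fin]
  ring

/-- The volume density of a Kähler form is continuous in each chart. -/
theorem continuousOn_volDensity {κ : X → Form n 2 ℝ} {Ω : Set X} (hκ : IsKahlerOn κ Ω) (c : X) :
    ContinuousOn (volDensity κ c) (chartSet n c Ω) := by
  have h1 : ContinuousOn (pull c κ) (chartSet n c Ω) := (hκ.smooth c).continuousOn
  refine Real.continuous_sqrt.comp_continuousOn ?_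
  have h2 : Continuous fun A : Form n 2 ℝ => Matrix.det (Matrix.of fun i j : Fin n × Fin 2 =>
      A ![stdBasis n i, J n (stdBasis n j)]) := by
    refine Continuous.matrix_det (continuous_matrix fun i j => ?_)
    exact (ContinuousAlternatingMap.apply ℝ (Cn n) ℝ ![stdBasis n i, J n (stdBasis n j)]).continuous
  exact h2.comp_continuousOn h1

theorem stdBasis_combination (a : Fin n × Fin 2 → ℝ) (m : Fin n) :
    (∑ i, a i • stdBasis n i) m = (a (m, 0) : ℂ) + a (m, 1) * Complex.I := by
  rw [Finset.sum_apply, Fintype.sum_prod_type, Finset.sum_eq_single m]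
  · simp [stdBasis, Fin.sum_univ_two]
  · intro b _ hb
    simp [stdBasis, hb.symm]
  · simp

theorem chartDeriv_injective [IsManifold 𝓘(ℂ, Cn n) ω X] (c : X) {z : Cn n}
    (hz : z ∈ (chartAt (Cn n) c).target) : Function.Injective (chartDeriv c z) := by
  have : IsManifold 𝓘(ℂ, Cn n) 1 X := IsManifold.of_le (n := ω) le_top
  have h := (mdifferentiable_chart (I := 𝓘(ℂ, Cn n)) c).symm.mfderiv_injective (x := z) hz
  exact h

/-- The volume density of a Kähler form is positive in each chart, as the square root of a Gram
determinant. -/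
theorem volDensity_pos [IsManifold 𝓘(ℂ, Cn n) ω X] {κ : X → Form n 2 ℝ} {Ω : Set X}
    (hκ : IsKahlerOn κ Ω) (c : X) {z : Cn n} (hz : z ∈ chartSet n c Ω) :
    0 < volDensity κ c z := by
  refine Real.sqrt_pos.2 (Matrix.PosDef.det_pos ?_)
  have hb : ∀ v w : Cn n, pull c κ z ![v, J n w] = metricForm (pull c κ z) v w := fun _ _ => rfl
  have hsymm : ∀ v w : Cn n, metricForm (pull c κ z) v w = metricForm (pull c κ z) w v := by
    intro v w
    rw [metricForm_apply, metricForm_apply, pull_metric_apply, pull_metric_apply]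
    exact metricForm_symm (hκ.type _ hz.2) _ _
  refine Matrix.PosDef.of_dotProduct_mulVec_pos ?_ fun a ha => ?_
  · ext i j
    simp only [Matrix.conjTranspose_apply, Matrix.of_apply, hb, star_trivial]
    exact hsymm _ _
  · let v : Cn n := ∑ i, a i • stdBasis n i
    have hv : v ≠ 0 := by
      intro hv
      apply ha
      funext ⟨m, l⟩
      have h1 : (a (m, 0) : ℂ) + a (m, 1) * Complex.I = 0 := by
        rw [← stdBasis_combination a m]
        exact congrFun hv m
      have h2 := congrArg Complex.re h1
      have h3 := congrArg Complex.im h1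
      simp at h2 h3
      fin_cases l
      · simpa using h2
      · simpa using h3
    have h1 : 0 < metricForm (pull c κ z) v v := by
      rw [metricForm_apply, pull_metric_apply]
      refine hκ.pos _ hz.2 _ fun h => hv ?_
      exact chartDeriv_injective c hz.1 (h.trans (map_zero _).symm)
    have h2 : metricForm (pull c κ z) v v = star a ⬝ᵥ (Matrix.of fun i j : Fin n × Fin 2 =>
        pull c κ z ![stdBasis n i, J n (stdBasis n j)]).mulVec a := by
      simp only [v, map_sum, LinearMap.sum_apply, map_smul, LinearMap.smul_apply, smul_eq_mul,
        dotProduct, Matrix.mulVec, Matrix.of_apply, hb, star_trivial, Finset.mul_sum]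
      rw [Finset.sum_comm]
      refine Finset.sum_congr rfl fun i _ => Finset.sum_congr rfl fun j _ => ?_
      ring
    rwa [← h2]

end Chart

/-! ### The Kähler volume and local square integrability -/

section Volume

variable {n : ℕ} {X : Type*} [TopologicalSpace X] [ChartedSpace (Cn n) X]

theorem isOpen_chartSet (c : X) {U : Set X} (hU : IsOpen U) : IsOpen (chartSet n c U) :=
  (chartAt (Cn n) c).isOpen_inter_preimage_symm hU

variable [MeasurableSpace X] [BorelSpace X]

theorem aemeasurable_chart_symm (c : X) :
    AEMeasurable (chartAt (Cn n) c).symm (volume.restrict (chartAt (Cn n) c).target) :=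
  (chartAt (Cn n) c).symm.continuousOn.aemeasurable (chartAt (Cn n) c).open_target.measurableSet

/-- A measurable set that is a null set in each chart is a null set for the Kähler volume. The
volume is a supremum over uncountably many charts, so the set is compared with the greatest measure
supported on its complement. -/
theorem kahlerVolume_eq_zero (κ : X → Form n 2 ℝ) {N : Set X} (hN : MeasurableSet N)
    (hnull : ∀ c : X, volume (chartSet n c N) = 0) : kahlerVolume κ N = 0 := by
  have hle : kahlerVolume κ ≤ (⊤ : Measure X).restrict Nᶜ := by
    refine iSup_le fun c => Measure.le_iff.2 fun t ht => ?_
    set ν := (volume.restrict (chartAt (Cn n) c).target).withDensity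
      fun z => ENNReal.ofReal (volDensity κ c z)
    have hac : ν ≪ volume.restrict (chartAt (Cn n) c).target := withDensity_absolutelyContinuous _ _
    have h0 : Measure.map (chartAt (Cn n) c).symm ν N = 0 := by
      rw [Measure.map_apply_of_aemeasurable ((aemeasurable_chart_symm c).mono_ac hac) hN]
      refine hac ?_
      rw [Measure.restrict_apply' (chartAt (Cn n) c).open_target.measurableSet, inter_comm]
      exact hnull c
    rw [Measure.restrict_apply ht]
    calc Measure.map (chartAt (Cn n) c).symm ν t
        ≤ Measure.map (chartAt (Cn n) c).symm ν (t ∩ Nᶜ ∪ N) :=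
          measure_mono fun x hx => (em (x ∈ N)).elim Or.inr fun h => Or.inl ⟨hx, h⟩
      _ ≤ _ := (measure_union_le _ _).trans (by rw [h0, add_zero])
      _ ≤ _ := (le_top : Measure.map (chartAt (Cn n) c).symm ν ≤ ⊤) _
  refine le_antisymm ((hle N).trans ?_) bot_le
  rw [Measure.restrict_apply hN, inter_compl_self, measure_empty]

/-- An integral in a chart is bounded by the integral for the Kähler volume, where the density of
the latter is bounded below. The integrand `F` on the manifold need not be measurable. -/
theorem lintegral_chart_le (κ : X → Form n 2 ℝ) (c : X) {K : Set (Cn n)} (hK : MeasurableSet K)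
    (hKt : K ⊆ (chartAt (Cn n) c).target) {δ : ℝ≥0∞}
    (hδ : ∀ z ∈ K, δ ≤ ENNReal.ofReal (volDensity κ c z)) {G : Cn n → ℝ≥0∞}
    (hG : AEMeasurable G (volume.restrict K)) {F : X → ℝ≥0∞} {A : Set X} (hA : MeasurableSet A)
    (hKA : ∀ z ∈ K, (chartAt (Cn n) c).symm z ∈ A)
    (hle : ∀ᵐ z ∂(volume.restrict K), G z ≤ F ((chartAt (Cn n) c).symm z)) :
    δ * ∫⁻ z in K, G z ≤ ∫⁻ x in A, F x ∂(kahlerVolume κ) := by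
  set φ := chartAt (Cn n) c
  have hmk : ∀ᵐ z ∂(volume.restrict K), hG.mk G z ≤ F (φ.symm z) := by
    filter_upwards [hle, hG.ae_eq_mk] with z h1 h2
    rwa [← h2]
  -- A measurable minorant, which lies below `F` everywhere.
  let bad : Set (Cn n) := toMeasurable (volume.restrict K) {z | ¬ hG.mk G z ≤ F (φ.symm z)}
  have hbad0 : volume.restrict K bad = 0 := by
    rw [measure_toMeasurable]
    exact hmk
  have hgood : ∀ z ∉ bad, hG.mk G z ≤ F (φ.symm z) := by
    intro z hz
    by_contra h
    exact hz (subset_toMeasurable _ _ h)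
  let G' : Cn n → ℝ≥0∞ := (K \ bad).indicator (hG.mk G)
  have hG' : Measurable G' :=
    hG.measurable_mk.indicator (hK.diff (measurableSet_toMeasurable _ _))
  classical
  let φ' : X → Cn n := φ.source.piecewise φ fun _ => 0
  have hφ' : Measurable φ' :=
    ContinuousOn.measurable_piecewise φ.continuousOn continuousOn_const φ.open_source.measurableSet
  let H : X → ℝ≥0∞ := φ.source.indicator (G' ∘ φ')
  have hH : Measurable H := (hG'.comp hφ').indicator φ.open_source.measurableSet
  have hHF : ∀ x, H x ≤ F x := by
    intro x
    by_cases hx : x ∈ φ.source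
    · have h1 : φ' x = φ x := piecewise_eq_of_mem _ _ _ hx
      simp only [H, indicator_of_mem hx, Function.comp_apply, h1, G']
      by_cases hy : φ x ∈ K \ bad
      · rw [indicator_of_mem hy]
        have := hgood _ hy.2
        rwa [φ.left_inv hx] at this
      · simp [indicator_of_notMem hy]
    · simp [H, indicator_of_notMem hx]
  have hAH : Measurable (A.indicator H) := hH.indicator hA
  set ν := (volume.restrict φ.target).withDensity fun z => ENNReal.ofReal (volDensity κ c z)
  have hac : ν ≪ volume.restrict φ.target := withDensity_absolutelyContinuous _ _
  have hν : δ • volume.restrict K ≤ ν := by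
    have h1 : (volume.restrict φ.target).withDensity (K.indicator fun _ => δ) ≤ ν := by
      refine withDensity_mono (Eventually.of_forall fun z => ?_)
      by_cases hz : z ∈ K
      · simpa [hz] using hδ z hz
      · simp [hz]
    rwa [withDensity_indicator hK, withDensity_const, Measure.restrict_restrict hK,
      inter_eq_left.2 hKt] at h1
  have hGH : ∀ᵐ z ∂(volume.restrict K), G z ≤ A.indicator H (φ.symm z) := by
    filter_upwards [hG.ae_eq_mk, ae_restrict_mem hK, measure_eq_zero_iff_ae_notMem.1 hbad0]
      with z h1 h2 h3
    have h4 : φ.symm z ∈ φ.source := φ.map_target (hKt h2)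
    have h5 : φ' (φ.symm z) = z := by
      rw [show φ' (φ.symm z) = φ (φ.symm z) from piecewise_eq_of_mem _ _ _ h4,
        φ.right_inv (hKt h2)]
    have h6 : H (φ.symm z) = G' (φ' (φ.symm z)) := indicator_of_mem h4 _
    have h7 : G' z = hG.mk G z := indicator_of_mem (s := K \ bad) (mem_sdiff_of_mem h2 h3) _
    rw [indicator_of_mem (hKA z h2), h6, h5, h7, h1]
  calc δ * ∫⁻ z in K, G z ≤ δ * ∫⁻ z in K, A.indicator H (φ.symm z) := by
        exact mul_le_mul' le_rfl (lintegral_mono_ae hGH)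
    _ = ∫⁻ z, A.indicator H (φ.symm z) ∂(δ • volume.restrict K) := by
        rw [lintegral_smul_measure, smul_eq_mul]
    _ ≤ ∫⁻ z, A.indicator H (φ.symm z) ∂ν := lintegral_mono' hν le_rfl
    _ = ∫⁻ x, A.indicator H x ∂(Measure.map φ.symm ν) :=
        (lintegral_map' hAH.aemeasurable ((aemeasurable_chart_symm c).mono_ac hac)).symm
    _ ≤ ∫⁻ x, A.indicator H x ∂(kahlerVolume κ) :=
        lintegral_mono' (le_iSup (fun c : X => Measure.map (chartAt (Cn n) c).symm
          ((volume.restrict (chartAt (Cn n) c).target).withDensity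
            fun z => ENNReal.ofReal (volDensity κ c z))) c) le_rfl
    _ = ∫⁻ x in A, H x ∂(kahlerVolume κ) := lintegral_indicator hA _
    _ ≤ ∫⁻ x in A, F x ∂(kahlerVolume κ) := lintegral_mono hHF

variable {r : ℕ} {E : X → Type*} [∀ x, AddCommGroup (E x)] [∀ x, Module ℂ (E x)]
  [TopologicalSpace (TotalSpace (Cn r) E)] [∀ x, TopologicalSpace (E x)]
  [FiberBundle (Cn r) E]

/-- If the metric `h` is locally bounded below by a multiple of the standard metric in the frame
`s`, then a form of finite energy is locally square integrable in charts. -/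
theorem exists_nhds_memLp_pull [IsManifold 𝓘(ℂ, Cn n) ω X] (h : SingularHermitianMetric n r E)
    {Ω : Set X} (hΩ : IsOpen Ω) {s : Fin r → ∀ x, E x} {κ : X → Form n 2 ℝ} {ψ : X → ℝ}
    (hκ : IsKahlerOn κ Ω) (hψ : ContinuousOn ψ Ω)
    (hlow : ∀ x₀ ∈ Ω, ∃ C : ℝ, 0 < C ∧ ∀ᶠ x in 𝓝 x₀,
      (∀ v : E x, v ≠ 0 → 0 < h.norm x v ∧ h.norm x v < ⊤) →
      ∀ a : Cn r, ‖a‖ₑ ≤ ENNReal.ofReal C * h.norm x (∑ i, a i • s i x))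
    {k : ℕ} {u : X → Form n k (Cn r)}
    (hmeas : ∀ c : X, AEStronglyMeasurable (pull c u) (volume.restrict (chartSet n c Ω)))
    (henergy : h.energy s κ ψ Ω u u < ⊤) (c : X) {z₀ : Cn n} (hz₀ : z₀ ∈ chartSet n c Ω) :
    ∃ V ∈ 𝓝 z₀, MemLp (pull c u) 2 (volume.restrict V) := by
  set φ := chartAt (Cn n) c
  have hΩo : IsOpen (chartSet n c Ω) := isOpen_chartSet c hΩ
  have hcs : ContinuousAt φ.symm z₀ := φ.symm.continuousAt hz₀.1
  obtain ⟨C, hC0, hC⟩ := hlow _ hz₀.2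
  -- Local bounds for the Kähler form, its volume density and the weight.
  let M : ℝ := Real.sqrt (‖pull c κ z₀‖ + 1)
  have hM2 : M ^ 2 = ‖pull c κ z₀‖ + 1 := Real.sq_sqrt (by positivity)
  have hM0 : 0 ≤ M := Real.sqrt_nonneg _
  have hb1 : ∀ᶠ z in 𝓝 z₀, ‖pull c κ z‖ < M ^ 2 := by
    rw [hM2]
    have h1 : ContinuousAt (pull c κ) z₀ :=
      (hκ.smooth c).continuousOn.continuousAt (hΩo.mem_nhds hz₀)
    exact h1.norm.eventually (gt_mem_nhds (lt_add_one _))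
  have hd0 := volDensity_pos hκ c hz₀
  have hb2 : ∀ᶠ z in 𝓝 z₀, volDensity κ c z₀ / 2 < volDensity κ c z :=
    ((continuousOn_volDensity hκ c).continuousAt (hΩo.mem_nhds hz₀)).eventually
      (lt_mem_nhds (half_lt_self hd0))
  let ε : ℝ := Real.exp (-ψ (φ.symm z₀)) / 2
  have hε : 0 < ε := by positivity
  have hb3 : ∀ᶠ z in 𝓝 z₀, ε < Real.exp (-ψ (φ.symm z)) := by
    have h1 : ContinuousAt ψ (φ.symm z₀) := hψ.continuousAt (hΩ.mem_nhds hz₀.2)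
    have h2 : ContinuousAt (fun z => Real.exp (-ψ (φ.symm z))) z₀ :=
      Real.continuous_exp.continuousAt.comp (ContinuousAt.comp (g := ψ) h1 hcs).neg
    exact h2.eventually (lt_mem_nhds (half_lt_self (Real.exp_pos _)))
  have hΩev : ∀ᶠ z in 𝓝 z₀, z ∈ chartSet n c Ω := hΩo.mem_nhds hz₀
  obtain ⟨V, hVsub, hVo, hzV⟩ := mem_nhds_iff.1
    (hΩev.and (hb1.and (hb2.and (hb3.and (hcs.eventually hC)))))
  refine ⟨V, hVo.mem_nhds hzV, ?_⟩
  have hVΩ : V ⊆ chartSet n c Ω := fun z hz => (hVsub hz).1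
  have hVt : V ⊆ φ.target := fun z hz => (hVΩ hz).1
  have hsm : AEStronglyMeasurable (pull c u) (volume.restrict V) :=
    (hmeas c).mono_measure (Measure.restrict_mono hVΩ le_rfl)
  have hfp : ∀ᵐ z ∂(volume.restrict V), ∀ v : E (φ.symm z), v ≠ 0 →
      0 < h.norm (φ.symm z) v ∧ h.norm (φ.symm z) v < ⊤ :=
    ae_mono (Measure.restrict_mono hVt le_rfl) (h.finite_pos c)
  let P : ℝ := Fintype.card (Fin k → Fin n × Fin 2)
  let C₁ : ℝ := (M ^ k) ^ 2 * P * (k.factorial * C ^ 2)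
  have hpt : ∀ᵐ z ∂(volume.restrict V), ‖pull c u z‖ₑ ^ 2 ≤
      ENNReal.ofReal (C₁ / ε) * ENNReal.ofReal ((h.inner s κ (φ.symm z) (u (φ.symm z))
        (u (φ.symm z))).re * Real.exp (-ψ (φ.symm z))) := by
    filter_upwards [hfp, ae_restrict_mem hVo.measurableSet] with z hz hzV
    obtain ⟨hzΩ, h1, -, h3, h4⟩ := hVsub hzV
    set x := φ.symm z
    let N : Cn r → ℝ≥0∞ := fun a => h.norm x (∑ i, a i • s i x)
    have hN : ∀ (b : ℂ) a, N (b • a) = ‖b‖ₑ * N a := by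
      intro b a
      simp only [N, Pi.smul_apply, smul_assoc, ← Finset.smul_sum, h.norm_smul]
    have hNfin : ∀ a, N a ≠ ⊤ := by
      intro a
      by_cases h0 : ∑ i, a i • s i x = 0
      · have : h.norm x 0 = 0 := by simpa using h.norm_smul x 0 0
        simp [N, h0, this]
      · exact (hz _ h0).2.ne
    have h5 := norm_pull_le c z (hκ.type x hzΩ.2) (hκ.pos x hzΩ.2) hM0 h1.le u
    have h6 := sum_norm_sq_le_formInner (e := onb (κ x)) hN hNfin hC0.le (h4 hz) (u x)
    have h7 : ‖pull c u z‖ ^ 2 ≤ C₁ * (h.inner s κ x (u x) (u x)).re := by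
      calc ‖pull c u z‖ ^ 2 ≤ (M ^ k * ∑ i : Fin k → Fin n × Fin 2, ‖u x (onb (κ x) ∘ i)‖) ^ 2 := by
            gcongr
        _ = (M ^ k) ^ 2 * (∑ i : Fin k → Fin n × Fin 2, ‖u x (onb (κ x) ∘ i)‖) ^ 2 := by
            rw [mul_pow]
        _ ≤ (M ^ k) ^ 2 * (P * ∑ i : Fin k → Fin n × Fin 2, ‖u x (onb (κ x) ∘ i)‖ ^ 2) := by
            gcongr
            exact sq_sum_le_card_mul_sum_sq
        _ ≤ (M ^ k) ^ 2 * (P * (k.factorial * C ^ 2 * (h.inner s κ x (u x) (u x)).re)) := by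
            gcongr
            exact h6
        _ = _ := by simp only [C₁]; ring
    have h8 : 0 ≤ C₁ * (h.inner s κ x (u x) (u x)).re := (sq_nonneg _).trans h7
    rw [← ENNReal.ofReal_mul (by positivity), ← ofReal_norm, ← ENNReal.ofReal_pow (norm_nonneg _)]
    refine ENNReal.ofReal_le_ofReal ?_
    calc ‖pull c u z‖ ^ 2 ≤ C₁ * (h.inner s κ x (u x) (u x)).re := h7
      _ = (C₁ * (h.inner s κ x (u x) (u x)).re) * ε / ε := by field_simp
      _ ≤ (C₁ * (h.inner s κ x (u x) (u x)).re) * Real.exp (-ψ x) / ε := by gcongr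
      _ = _ := by ring
  have hle := lintegral_chart_le κ c hVo.measurableSet hVt
    (δ := ENNReal.ofReal (volDensity κ c z₀ / 2))
    (fun z hz => ENNReal.ofReal_le_ofReal (hVsub hz).2.2.1.le)
    (hsm.enorm.pow_const 2) hΩ.measurableSet (fun z hz => (hVΩ hz).2)
    (F := fun x => ENNReal.ofReal (C₁ / ε) * ENNReal.ofReal ((h.inner s κ x (u x) (u x)).re *
      Real.exp (-ψ x))) hpt
  rw [lintegral_const_mul' _ _ ENNReal.ofReal_ne_top] at hle
  have hfin : ENNReal.ofReal (volDensity κ c z₀ / 2) * ∫⁻ z in V, ‖pull c u z‖ₑ ^ 2 < ⊤ :=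
    hle.trans_lt (ENNReal.mul_lt_top ENNReal.ofReal_lt_top henergy)
  have hδ0 : ENNReal.ofReal (volDensity κ c z₀ / 2) ≠ 0 := by
    simpa using hd0
  have hfin2 : ∫⁻ z in V, ‖pull c u z‖ₑ ^ 2 < ⊤ := by
    by_contra htop
    rw [not_lt_top_iff] at htop
    rw [htop, ENNReal.mul_top hδ0] at hfin
    exact lt_irrefl _ hfin
  refine ⟨hsm, ?_⟩
  rw [eLpNorm_lt_top_iff_lintegral_rpow_enorm_lt_top (by norm_num) (by norm_num)]
  simpa using hfin2

end Volume

/-! ### The dual frame and a lower bound for the metric -/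

section Frame

theorem mdifferentiableAt_pi {n r m : ℕ} {X : Type*} [TopologicalSpace X] [ChartedSpace (Cn n) X]
    {C : X → Fin r → Cn m} {x : X}
    (h : ∀ j, MDifferentiableAt 𝓘(ℂ, Cn n) 𝓘(ℂ, Cn m) (fun y => C y j) x) :
    MDifferentiableAt 𝓘(ℂ, Cn n) 𝓘(ℂ, Fin r → Cn m) C x := by
  rw [mdifferentiableAt_iff]
  exact ⟨continuousAt_pi.2 fun j => (h j).continuousAt, differentiableWithinAt_pi.2 fun j =>
    ((mdifferentiableAt_iff _ _).1 (h j)).2⟩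

variable {n r : ℕ} {X : Type*} [TopologicalSpace X] [ChartedSpace (Cn n) X]
  {E : X → Type*} [∀ x, AddCommGroup (E x)] [∀ x, Module ℂ (E x)]
  [TopologicalSpace (TotalSpace (Cn r) E)] [∀ x, TopologicalSpace (E x)]
  [FiberBundle (Cn r) E] [VectorBundle ℂ (Cn r) E]

/-- A holomorphic frame has a holomorphic dual frame: in a local trivialization, its coefficients
are given by the inverse of the matrix of the frame. -/
theorem exists_dual_frame [IsManifold 𝓘(ℂ, Cn n) ω X]
    [ContMDiffVectorBundle ω (Cn r) E 𝓘(ℂ, Cn n)] {s : Fin r → ∀ x, E x} {Ω : Set X}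
    (hs : HolFrameOn n s Ω) :
    ∃ ξ : Fin r → ∀ x, E x →ₗ[ℂ] ℂ,
      (∀ x ∈ Ω, ∀ (a : Cn r) i, ξ i x (∑ j, a j • s j x) = a i) ∧
      ∀ i, HolDualSectionOn n r (ξ i) Ω := by
  classical
  have hspan : ∀ x ∈ Ω, ⊤ ≤ Submodule.span ℂ (range fun i => s i x) := by
    intro x hx
    have e := (trivializationAt (Cn r) E x).linearEquivAt ℂ x (mem_baseSet_trivializationAt _ _ x)
    have : FiniteDimensional ℂ (E x) := Module.Finite.equiv e.symm
    refine ((hs.2 x hx).span_eq_top_of_card_eq_finrank' ?_).ge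
    rw [e.finrank_eq]
    simp
  let b : ∀ x, x ∈ Ω → Module.Basis (Fin r) ℂ (E x) := fun x hx =>
    Module.Basis.mk (hs.2 x hx) (hspan x hx)
  have hb : ∀ x (hx : x ∈ Ω) (a : Cn r), (b x hx).equivFun.symm a = ∑ j, a j • s j x := by
    intro x hx a
    simp [b, Module.Basis.equivFun_symm_apply]
  let ξ : Fin r → ∀ x, E x →ₗ[ℂ] ℂ := fun i x => if hx : x ∈ Ω then (b x hx).coord i else 0
  have hξ : ∀ i x (hx : x ∈ Ω) v, ξ i x v = (b x hx).equivFun v i := by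
    intro i x hx v
    simp [ξ, hx]
  refine ⟨ξ, fun x hx a i => ?_, fun i V σ hV hVΩ hσ x₀ hx₀ => ?_⟩
  · rw [hξ i x hx, ← hb x hx, LinearEquiv.apply_symm_apply]
  set e := trivializationAt (Cn r) E x₀
  let T : (Fin r → Cn r) →ₗ[ℂ] (Cn r →L[ℂ] Cn r) :=
    { toFun := fun C => ∑ j,
        (ContinuousLinearMap.proj (R := ℂ) (φ := fun _ : Fin r => ℂ) j).smulRight (C j)
      map_add' := fun C D => by
        ext a
        simp [Finset.sum_add_distrib]
      map_smul' := fun m C => by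
        ext a
        simp [Finset.mul_sum, mul_left_comm] }
  have hT : ∀ (C : Fin r → Cn r) a, T C a = ∑ j, a j • C j := by
    intro C a
    simp [T]
  let Φ : (Fin r → Cn r) × Cn r → ℂ := fun p => (T p.1).inverse p.2 i
  let C : X → (Fin r → Cn r) := fun x j => (e ⟨x, s j x⟩).2
  let w : X → Cn r := fun x => (e ⟨x, σ x⟩).2
  have hx₀e : x₀ ∈ e.baseSet := mem_baseSet_trivializationAt _ _ x₀
  let L : ∀ x, x ∈ Ω → x ∈ e.baseSet → (Cn r ≃L[ℂ] Cn r) := fun x hx hxe =>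
    ((b x hx).equivFun.symm.trans (e.linearEquivAt ℂ x hxe)).toContinuousLinearEquiv
  have hL : ∀ x (hx : x ∈ Ω) (hxe : x ∈ e.baseSet), T (C x) = L x hx hxe := by
    intro x hx hxe
    ext1 a
    rw [hT]
    change _ = e.linearEquivAt ℂ x hxe ((b x hx).equivFun.symm a)
    rw [hb x hx, map_sum]
    refine Finset.sum_congr rfl fun j _ => ?_
    rw [map_smul]
    rfl
  have hΦ : DifferentiableAt ℂ Φ (C x₀, w x₀) := by
    have hinv : DifferentiableAt ℂ (ContinuousLinearMap.inverse : (Cn r →L[ℂ] Cn r) → _)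
        (T (C x₀)) := by
      rw [hL x₀ (hVΩ hx₀) hx₀e]
      exact (contDiffAt_map_inverse (n := 1) _).differentiableAt one_ne_zero
    have hTd : DifferentiableAt ℂ (fun p : (Fin r → Cn r) × Cn r => T p.1) (C x₀, w x₀) :=
      (LinearMap.toContinuousLinearMap T).differentiableAt.comp _ differentiableAt_fst
    have h1 : DifferentiableAt ℂ (fun p : (Fin r → Cn r) × Cn r => (T p.1).inverse p.2)
        (C x₀, w x₀) :=
      (DifferentiableAt.comp (C x₀, w x₀) (g := ContinuousLinearMap.inverse) hinv hTd).clm_apply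
        differentiableAt_snd
    exact differentiableAt_pi.1 h1 i
  have hsec : ∀ τ : ∀ x, E x, HolSectionOn n r τ V →
      MDifferentiableAt 𝓘(ℂ, Cn n) 𝓘(ℂ, Cn r) (fun x => (e ⟨x, τ x⟩).2) x₀ := fun τ hτ =>
    (mdifferentiableAt_section _ τ).1 ((hτ x₀ hx₀).mdifferentiableAt (hV.mem_nhds hx₀))
  have hC : MDifferentiableAt 𝓘(ℂ, Cn n) 𝓘(ℂ, Fin r → Cn r) C x₀ :=
    mdifferentiableAt_pi fun j => hsec (s j) ((hs.1 j).mono hVΩ)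
  have hcomp : MDifferentiableAt 𝓘(ℂ, Cn n) 𝓘(ℂ, ℂ) (fun x => Φ (C x, w x)) x₀ :=
    (hΦ.mdifferentiableAt).comp x₀ (hC.prodMk_space (hsec σ hσ))
  refine (hcomp.congr_of_eventuallyEq ?_).mdifferentiableWithinAt
  filter_upwards [hV.mem_nhds hx₀, e.open_baseSet.mem_nhds hx₀e] with x hxV hxe
  have hxΩ := hVΩ hxV
  simp only [Φ]
  rw [hξ i x hxΩ, hL x hxΩ hxe, ContinuousLinearMap.inverse_equiv]
  have h1 : w x = L x hxΩ hxe ((b x hxΩ).equivFun (σ x)) := by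
    change _ = e.linearEquivAt ℂ x hxe ((b x hxΩ).equivFun.symm ((b x hxΩ).equivFun (σ x)))
    rw [LinearEquiv.symm_apply_apply]
    rfl
  rw [h1]
  simp

/-- A Griffiths semi-positive metric is locally bounded below: the dual metric is plurisubharmonic,
hence locally bounded above, on the sections of the dual frame. -/
theorem SingularHermitianMetric.GriffithsSemipositiveOn.exists_lower_bound
    [IsManifold 𝓘(ℂ, Cn n) ω X] [ContMDiffVectorBundle ω (Cn r) E 𝓘(ℂ, Cn n)]
    {h : SingularHermitianMetric n r E} {Ω : Set X} (hG : h.GriffithsSemipositiveOn Ω)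
    {s : Fin r → ∀ x, E x} (hΩ : IsOpen Ω) (hs : HolFrameOn n s Ω) {x₀ : X} (hx₀ : x₀ ∈ Ω) :
    ∃ C : ℝ, 0 < C ∧ ∀ᶠ x in 𝓝 x₀,
      (∀ v : E x, v ≠ 0 → 0 < h.norm x v ∧ h.norm x v < ⊤) →
      ∀ a : Cn r, ‖a‖ₑ ≤ ENNReal.ofReal C * h.norm x (∑ i, a i • s i x) := by
  obtain ⟨ξ, hξ, hhol⟩ := exists_dual_frame hs
  have hpsh := fun i => hG Ω (ξ i) hΩ subset_rfl (hhol i)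
  let m : ℝ≥0∞ := ∑ i, h.dualNorm x₀ (ξ i x₀)
  have hm : m ≠ ⊤ := ENNReal.sum_ne_top.2 fun i _ => (hpsh i).2.1 x₀ hx₀
  let C : ℝ := m.toReal + 1
  have hCm : m < ENNReal.ofReal C := by
    rw [ENNReal.lt_ofReal_iff_toReal_lt hm]
    exact lt_add_one _
  have hev : ∀ i, ∀ᶠ x in 𝓝 x₀, h.dualNorm x (ξ i x) < ENNReal.ofReal C := by
    intro i
    have h1 := (hpsh i).1 x₀ hx₀ (ENNReal.ofReal C)
      ((Finset.single_le_sum (f := fun i => h.dualNorm x₀ (ξ i x₀)) (fun _ _ => bot_le)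
        (Finset.mem_univ i)).trans_lt hCm)
    rwa [hΩ.nhdsWithin_eq hx₀] at h1
  refine ⟨C, by positivity, ?_⟩
  filter_upwards [hΩ.mem_nhds hx₀, eventually_all.2 hev] with x hx hC hpos a
  set v := ∑ i, a i • s i x with hv
  have hcoord : ∀ i, ξ i x v = a i := fun i => hξ x hx a i
  by_cases hv0 : v = 0
  · have ha : a = 0 := funext fun i => by rw [← hcoord i, hv0, map_zero]; rfl
    simp [ha]
  obtain ⟨hN0, hNtop⟩ := hpos v hv0
  set N := h.norm x v
  have hNr : 0 < N.toReal := ENNReal.toReal_pos hN0.ne' hNtop.ne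
  have hbound : ∀ i, ‖a i‖ₑ ≤ ENNReal.ofReal C * N := by
    intro i
    -- The vector `v` is scaled to unit length.
    let t : ℂ := ((N.toReal)⁻¹ : ℝ)
    have ht : ‖t‖ₑ = N⁻¹ := by
      rw [← ofReal_norm, Complex.norm_real, Real.norm_of_nonneg (by positivity),
        ENNReal.ofReal_inv_of_pos hNr, ENNReal.ofReal_toReal hNtop.ne]
    have h1 : h.norm x (t • v) ≤ 1 := by
      rw [h.norm_smul, ht, ENNReal.inv_mul_cancel hN0.ne' hNtop.ne]
    have h2 : ‖ξ i x (t • v)‖ₑ ≤ h.dualNorm x (ξ i x) :=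
      le_iSup₂ (f := fun (v : E x) (_ : h.norm x v ≤ 1) => ‖ξ i x v‖ₑ) (t • v) h1
    rw [map_smul, hcoord, smul_eq_mul, enorm_mul, ht] at h2
    calc ‖a i‖ₑ = N⁻¹ * ‖a i‖ₑ * N := by
          rw [mul_comm N⁻¹, mul_assoc, ENNReal.inv_mul_cancel hN0.ne' hNtop.ne, mul_one]
      _ ≤ ENNReal.ofReal C * N := mul_le_mul' (h2.trans (hC i).le) le_rfl
  have hfin : ENNReal.ofReal C * N ≠ ⊤ := ENNReal.mul_ne_top ENNReal.ofReal_ne_top hNtop.ne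
  rw [← ofReal_norm, ENNReal.ofReal_le_iff_le_toReal hfin]
  refine (pi_norm_le_iff_of_nonneg ENNReal.toReal_nonneg).2 fun i => ?_
  rw [← ENNReal.ofReal_le_iff_le_toReal hfin, ofReal_norm]
  exact hbound i

end Frame

/-! ### Intersections of Stein open sets -/

section Stein

variable {n : ℕ} {X : Type*} [TopologicalSpace X] [T2Space X] [ChartedSpace (Cn n) X]

/-- The hull of a compact set in the intersection is a closed subset of the intersection of its
hulls. -/
theorem IsSteinOn.inter {Ω Ω' : Set X} (hΩ : IsSteinOn n Ω) (hΩ' : IsSteinOn n Ω') :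
    IsSteinOn n (Ω ∩ Ω') := by
  refine ⟨hΩ.1.inter hΩ'.1, fun K hK hKc => ?_, fun x hx y hy hxy => ?_⟩
  · set Q := {x | x ∈ Ω ∧ ∀ g : X → ℂ, MDifferentiableOn 𝓘(ℂ, Cn n) 𝓘(ℂ, ℂ) g Ω →
      ∃ y ∈ K, ‖g x‖ ≤ ‖g y‖} ∩ {x | x ∈ Ω' ∧ ∀ g : X → ℂ,
        MDifferentiableOn 𝓘(ℂ, Cn n) 𝓘(ℂ, ℂ) g Ω' → ∃ y ∈ K, ‖g x‖ ≤ ‖g y‖} with hQ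
    have hQc : IsCompact Q := (hΩ.2.1 K (hK.trans inter_subset_left) hKc).inter
      (hΩ'.2.1 K (hK.trans inter_subset_right) hKc)
    have hQsub : Q ⊆ Ω ∩ Ω' := fun x hx => ⟨hx.1.1, hx.2.1⟩
    have heq : {x | x ∈ Ω ∩ Ω' ∧ ∀ g : X → ℂ,
        MDifferentiableOn 𝓘(ℂ, Cn n) 𝓘(ℂ, ℂ) g (Ω ∩ Ω') → ∃ y ∈ K, ‖g x‖ ≤ ‖g y‖} =
        Q ∩ ⋂ (g : X → ℂ) (_ : MDifferentiableOn 𝓘(ℂ, Cn n) 𝓘(ℂ, ℂ) g (Ω ∩ Ω')),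
          {x ∈ Q | ∃ y ∈ K, ‖g x‖ ≤ ‖g y‖} := by
      ext x
      simp only [mem_ofPred_eq, mem_inter_iff, mem_iInter]
      constructor
      · rintro ⟨hx, h⟩
        have hxQ : x ∈ Q := ⟨⟨hx.1, fun g hg => h g (hg.mono inter_subset_left)⟩,
          ⟨hx.2, fun g hg => h g (hg.mono inter_subset_right)⟩⟩
        exact ⟨hxQ, fun g hg => ⟨hxQ, h g hg⟩⟩
      · rintro ⟨hx, h⟩
        exact ⟨hQsub hx, fun g hg => (h g hg).2⟩
    rw [heq]
    refine hQc.inter_right (isClosed_iInter fun g => isClosed_iInter fun hg => ?_)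
    rcases K.eq_empty_or_nonempty with rfl | hne
    · simp
    have hgc : ContinuousOn (fun x => ‖g x‖) (Ω ∩ Ω') := hg.continuousOn.norm
    obtain ⟨y, hy, hmax⟩ := hKc.exists_isMaxOn hne (hgc.mono hK)
    have h1 : {x ∈ Q | ∃ y ∈ K, ‖g x‖ ≤ ‖g y‖} = Q ∩ (fun x => ‖g x‖) ⁻¹' Iic ‖g y‖ := by
      ext x
      simp only [mem_ofPred_eq, mem_inter_iff, mem_preimage, mem_Iic]
      exact and_congr_right fun _ => ⟨fun ⟨w, hw, h⟩ => h.trans (hmax hw), fun h => ⟨y, hy, h⟩⟩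
    rw [h1]
    exact (hgc.mono hQsub).preimage_isClosed_of_isClosed hQc.isClosed isClosed_Iic
  · obtain ⟨g, hg, hne⟩ := hΩ.2.2 x hx.1 y hy.1 hxy
    exact ⟨g, hg.mono inter_subset_left, hne⟩

end Stein

/-! ### Analytic subsets without interior -/

section Analytic

variable {n : ℕ} {X : Type*} [TopologicalSpace X] [ChartedSpace (Cn n) X]
  [IsManifold 𝓘(ℂ, Cn n) ω X] {S : Set X}

theorem differentiableOn_comp_chart_symm {g : X → ℂ} {U : Set X}
    (hg : MDifferentiableOn 𝓘(ℂ, Cn n) 𝓘(ℂ, ℂ) g U) (c : X) :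
    DifferentiableOn ℂ (g ∘ (chartAt (Cn n) c).symm) (chartSet n c U) := by
  rw [← mdifferentiableOn_iff_differentiableOn]
  have : IsManifold 𝓘(ℂ, Cn n) 1 X := IsManifold.of_le (n := ω) le_top
  exact hg.comp ((mdifferentiableOn_atlas_symm (chart_mem_atlas (Cn n) c)).mono inter_subset_left)
    fun z hz => hz.2

/-- In a small ball in a chart, an analytic subset is contained in the zero set of a holomorphic
function that is a null set, or contains the ball. -/
theorem IsAnalyticSubset.thin_or_ball_subset (hS : IsAnalyticSubset n S) (c : X) {z : Cn n}
    (hz : z ∈ (chartAt (Cn n) c).target) :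
    ∃ R > 0, Metric.ball z R ⊆ (chartAt (Cn n) c).target ∧
      ((∃ g : Cn n → ℂ, DifferentiableOn ℂ g (Metric.ball z R) ∧
        chartSet n c S ∩ Metric.ball z R ⊆ {y | g y = 0} ∧
        volume {y | y ∈ Metric.ball z R ∧ g y = 0} = 0) ∨ Metric.ball z R ⊆ chartSet n c S) := by
  obtain ⟨U, hU, hxU, m, g, hg, hSU⟩ := hS ((chartAt (Cn n) c).symm z)
  obtain ⟨R, hR, hball⟩ := Metric.isOpen_iff.1 (isOpen_chartSet (n := n) c hU) z ⟨hz, hxU⟩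
  refine ⟨R, hR, hball.trans inter_subset_left, ?_⟩
  have hd : ∀ i, DifferentiableOn ℂ (g i ∘ (chartAt (Cn n) c).symm) (Metric.ball z R) := fun i =>
    (differentiableOn_comp_chart_symm (hg i) c).mono hball
  by_cases hall : ∀ i, ∀ y ∈ Metric.ball z R, (g i ∘ (chartAt (Cn n) c).symm) y = 0
  · refine Or.inr fun y hy => ⟨(hball hy).1, ?_⟩
    have : (chartAt (Cn n) c).symm y ∈ S ∩ U := by
      rw [hSU]
      exact ⟨(hball hy).2, fun i => hall i y hy⟩
    exact this.1
  · obtain ⟨i, hi⟩ := not_forall.1 hall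
    refine Or.inl ⟨_, hd i, fun y hy => ?_,
      ((eqOn_zero_or_volume_zeros_eq_zero (hd i)).resolve_left hi)⟩
    have : (chartAt (Cn n) c).symm y ∈ S ∩ U := ⟨hy.1.2, (hball hy.2).2⟩
    rw [hSU] at this
    exact this.2 i

/-- The interior of an analytic subset is closed, by the identity theorem, so that it is a union of
connected components. -/
theorem IsAnalyticSubset.interior_eq_empty (hS : IsAnalyticSubset n S)
    (hproper : ∀ x : X, ¬ connectedComponent x ⊆ S) : interior S = ∅ := by
  have hclosed : IsClosed (interior S) := by
    refine isClosed_of_closure_subset fun x hx => ?_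
    set φ := chartAt (Cn n) x
    have hxs : x ∈ φ.source := mem_chart_source _ x
    obtain ⟨R, hR, hball, hcase⟩ := hS.thin_or_ball_subset x (φ.map_source hxs)
    have hnhds : φ.source ∩ φ ⁻¹' Metric.ball (φ x) R ∈ 𝓝 x :=
      (φ.isOpen_inter_preimage Metric.isOpen_ball).mem_nhds ⟨hxs, Metric.mem_ball_self hR⟩
    rcases hcase with ⟨g, -, hg0, hnull⟩ | hsub
    · exfalso
      obtain ⟨y, ⟨hys, hyb⟩, hyS⟩ := mem_closure_iff_nhds.1 hx _ hnhds
      have hopen : IsOpen (chartSet n x (interior S) ∩ Metric.ball (φ x) R) :=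
        (isOpen_chartSet x isOpen_interior).inter Metric.isOpen_ball
      have hmem : φ y ∈ chartSet n x (interior S) ∩ Metric.ball (φ x) R := by
        refine ⟨⟨φ.map_source hys, ?_⟩, hyb⟩
        change φ.symm (φ y) ∈ interior S
        rwa [φ.left_inv hys]
      refine (hopen.measure_pos volume ⟨_, hmem⟩).ne' (measure_mono_null (fun w hw => ?_) hnull)
      exact ⟨hw.2, hg0 ⟨⟨hw.1.1, interior_subset (s := S) hw.1.2⟩, hw.2⟩⟩
    · refine mem_interior_iff_mem_nhds.2 (mem_of_superset hnhds fun y hy => ?_)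
      have h1 := (hsub hy.2).2
      change φ.symm (φ y) ∈ S at h1
      rwa [φ.left_inv hy.1] at h1
  rw [eq_empty_iff_forall_notMem]
  exact fun x hx => hproper x
    ((IsClopen.connectedComponent_subset ⟨hclosed, isOpen_interior⟩ hx).trans interior_subset)

theorem IsAnalyticSubset.exists_thin (hS : IsAnalyticSubset n S) (hint : interior S = ∅) (c : X)
    {z : Cn n} (hz : z ∈ (chartAt (Cn n) c).target) :
    ∃ V, IsOpen V ∧ z ∈ V ∧ ∃ g : Cn n → ℂ, DifferentiableOn ℂ g V ∧
      chartSet n c S ∩ V ⊆ {y | g y = 0} ∧ volume {y | y ∈ V ∧ g y = 0} = 0 := by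
  obtain ⟨R, hR, hball, h | hsub⟩ := hS.thin_or_ball_subset c hz
  · exact ⟨Metric.ball z R, Metric.isOpen_ball, Metric.mem_ball_self hR, h⟩
  · let φ := chartAt (Cn n) c
    have h1 : φ.source ∩ φ ⁻¹' Metric.ball z R ⊆ interior S := by
      refine interior_maximal (fun y hy => ?_) (φ.isOpen_inter_preimage Metric.isOpen_ball)
      have h1 := (hsub hy.2).2
      change φ.symm (φ y) ∈ S at h1
      rwa [φ.left_inv hy.1] at h1
    have h2 : φ.symm z ∈ interior S := by
      refine h1 ⟨φ.map_target hz, ?_⟩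
      rw [mem_preimage, φ.right_inv hz]
      exact Metric.mem_ball_self hR
    rw [hint] at h2
    exact h2.elim

theorem IsAnalyticSubset.volume_chartSet_eq_zero (hS : IsAnalyticSubset n S)
    (hint : interior S = ∅) (c : X) : volume (chartSet n c S) = 0 := by
  refine measure_null_of_locally_null _ fun z hz => ?_
  obtain ⟨V, hV, hzV, g, -, hg0, hnull⟩ := hS.exists_thin hint c hz.1
  have hsub : chartSet n c S ∩ V ⊆ {y | y ∈ V ∧ g y = 0} := fun w hw => ⟨hw.2, hg0 hw⟩
  exact ⟨chartSet n c S ∩ V, inter_mem_nhdsWithin _ (hV.mem_nhds hzV),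
    measure_mono_null hsub hnull⟩

end Analytic

/-! ### Extension of solutions across the analytic subset -/

section Extension

variable {n r : ℕ} {X : Type*} [TopologicalSpace X] [ChartedSpace (Cn n) X]

theorem IsKahlerOn.mono {κ : X → Form n 2 ℝ} {Ω Ω' : Set X} (hκ : IsKahlerOn κ Ω) (hsub : Ω' ⊆ Ω) :
    IsKahlerOn κ Ω' where
  smooth c := (hκ.smooth c).mono fun _ hz => ⟨hz.1, hsub hz.2⟩
  closed c z hz := hκ.closed c z ⟨hz.1, hsub hz.2⟩
  type x hx := hκ.type x (hsub hx)
  pos x hx := hκ.pos x (hsub hx)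

theorem WeakDbarOn.mono {k : ℕ} {u : X → Form n k (Cn r)} {f : X → Form n (k + 1) (Cn r)}
    {Ω Ω' : Set X} (h : WeakDbarOn u f Ω) (hsub : Ω' ⊆ Ω) : WeakDbarOn u f Ω' := fun c => by
  have hc : chartSet n c Ω' ⊆ chartSet n c Ω := fun _ hz => ⟨hz.1, hsub hz.2⟩
  exact ⟨(h c).1.mono_set hc, (h c).2.1.mono_set hc,
    fun χ hχ hχc hχs => (h c).2.2 χ hχ hχc (hχs.trans hc)⟩

theorem wedgeOne_conjPart_zero {k : ℕ} (α : Form n k (Cn r)) :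
    wedgeOne α (conjPart (0 : Cn n →L[ℝ] ℂ)) = 0 := by
  simp [conjPart]

theorem locallyIntegrableOn_of_exists_nhds_memLp {G : Type*} [NormedAddCommGroup G]
    {u : Cn n → G} {D : Set (Cn n)}
    (hu : ∀ z ∈ D, ∃ V ∈ 𝓝 z, MemLp u 2 (volume.restrict V)) : LocallyIntegrableOn u D := by
  intro z hz
  obtain ⟨V, hV, hm⟩ := hu z hz
  refine ⟨V ∩ Metric.ball z 1,
    mem_nhdsWithin_of_mem_nhds (inter_mem hV (Metric.ball_mem_nhds z one_pos)), ?_⟩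
  have : IsFiniteMeasure (volume.restrict (V ∩ Metric.ball z 1)) :=
    ⟨by
      rw [Measure.restrict_apply_univ]
      exact (measure_mono inter_subset_right).trans_lt measure_ball_lt_top⟩
  exact (hm.mono_measure (Measure.restrict_mono inter_subset_left le_rfl)).integrable (by norm_num)

/-- If `∂̄u = f` on the complement of a thin closed set and `u` is locally square integrable, then
`∂̄u = f` also holds across this set. -/
theorem WeakDbarOn.extend_across [IsManifold 𝓘(ℂ, Cn n) ω X] {S Ω : Set X} (hΩ : IsOpen Ω)
    (hS : IsAnalyticSubset n S) (hint : interior S = ∅) {k : ℕ}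
    {u : X → Form n k (Cn r)} {f : X → Form n (k + 1) (Cn r)}
    (hu : ∀ c : X, ∀ z ∈ chartSet n c Ω, ∃ V ∈ 𝓝 z, MemLp (pull c u) 2 (volume.restrict V))
    (hf : ∀ c : X, LocallyIntegrableOn (pull c f) (chartSet n c Ω))
    (heq : WeakDbarOn u f (Ω ∩ Sᶜ)) : WeakDbarOn u f Ω := by
  intro c
  have hloc := locallyIntegrableOn_of_exists_nhds_memLp (hu c)
  refine ⟨hloc, hf c, fun χ hχ hχc hχs => ?_⟩
  obtain ⟨B, hB⟩ := exists_bilin_wedge_conjPart n k r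
  obtain ⟨P, hP⟩ := exists_bilin_smul n (k + 1) r
  have hext := weak_dbar_extend P B (D := chartSet n c Ω) (A := chartSet n c S)
    (u := pull c u) (F := pull c f) (fun z hz => ?_) (hu c) hloc (hf c)
    (fun χ hχ hχc hχs => ?_) hχ hχc hχs
  · simpa only [hP, hB] using hext
  · obtain ⟨V, hV, hzV, g, hg, hg0, hnull⟩ := hS.exists_thin hint c hz.1
    have hsub : {y | y ∈ V ∩ chartSet n c Ω ∧ g y = 0} ⊆ {y | y ∈ V ∧ g y = 0} :=
      fun w hw => ⟨hw.1.1, hw.2⟩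
    exact ⟨V ∩ chartSet n c Ω, hV.inter (isOpen_chartSet c hΩ), ⟨hzV, hz⟩, inter_subset_right, g,
      hg.mono inter_subset_left, fun w hw => hg0 ⟨hw.1, hw.2.1⟩,
      measure_mono_null hsub hnull⟩
  · have h1 := (heq c).2.2 χ hχ hχc fun z hz =>
      ⟨(hχs hz).1.1, (hχs hz).1.2, fun hzS => (hχs hz).2 ⟨(hχs hz).1.1, hzS⟩⟩
    simpa only [hP, hB] using h1

theorem WeakDbarOn.congr {k : ℕ} {u v : X → Form n k (Cn r)} {f : X → Form n (k + 1) (Cn r)}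
    {Ω : Set X} (hΩ : IsOpen Ω) (h : WeakDbarOn u f Ω) (huv : ∀ x ∈ Ω, u x = v x) :
    WeakDbarOn v f Ω := by
  intro c
  have hpull : ∀ z ∈ chartSet n c Ω, pull c u z = pull c v z := fun z hz => by
    rw [pull, pull, huv _ hz.2]
  refine ⟨fun z hz => ?_, (h c).2.1, fun χ hχ hχc hχs => ?_⟩
  · obtain ⟨t, ht, hint⟩ := (h c).1 z hz
    refine ⟨chartSet n c Ω ∩ t, inter_mem self_mem_nhdsWithin ht, ?_⟩
    have hC := (isOpen_chartSet (n := n) c hΩ).measurableSet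
    refine (hint.mono_set inter_subset_right).congr ?_
    rw [← Measure.restrict_restrict hC]
    filter_upwards [ae_restrict_mem hC] with y hy
    exact hpull y hy
  · rw [(h c).2.2 χ hχ hχc hχs]
    congr 2
    funext z
    by_cases hz : z ∈ tsupport χ
    · rw [hpull z (hχs hz)]
    · rw [image_eq_zero_of_notMem_tsupport fun h => hz (tsupport_fderiv_subset ℝ h),
        wedgeOne_conjPart_zero, wedgeOne_conjPart_zero]

end Extension

section Energy

variable {n r : ℕ} {X : Type*} [TopologicalSpace X] [ChartedSpace (Cn n) X]
  {E : X → Type*} [∀ x, AddCommGroup (E x)] [∀ x, Module ℂ (E x)]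
  [TopologicalSpace (TotalSpace (Cn r) E)] [∀ x, TopologicalSpace (E x)]
  [FiberBundle (Cn r) E] [MeasurableSpace X] (h : SingularHermitianMetric n r E)

/-- Null sets do not contribute to the energy, whatever the values of the forms on them. -/
theorem SingularHermitianMetric.energy_diff_null {k : ℕ} {s : Fin r → ∀ x, E x}
    {κ : X → Form n 2 ℝ} {ψ : X → ℝ} {Ω S : Set X} (hS : kahlerVolume κ S = 0)
    (α β : X → Form n k (Cn r)) :
    h.energy s κ ψ (Ω ∩ Sᶜ) α β = h.energy s κ ψ Ω α β := by
  have h1 : (Ω ∩ Sᶜ : Set X) =ᵐ[kahlerVolume κ] Ω := by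
    rw [← sdiff_eq]
    exact sdiff_null_ae_eq_self hS
  rw [energy, energy, Measure.restrict_congr_set h1]

theorem SingularHermitianMetric.energy_congr [BorelSpace X] {k : ℕ} {s : Fin r → ∀ x, E x}
    {κ : X → Form n 2 ℝ} {ψ : X → ℝ} {Ω : Set X} (hΩ : IsOpen Ω) {α β α' β' : X → Form n k (Cn r)}
    (hα : ∀ x ∈ Ω, α x = α' x) (hβ : ∀ x ∈ Ω, β x = β' x) :
    h.energy s κ ψ Ω α β = h.energy s κ ψ Ω α' β' := by
  refine setLIntegral_congr_fun hΩ.measurableSet fun x hx => ?_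
  simp only [hα x hx, hβ x hx]

end Energy

end SHM

end

theorem mainTheorem10 {n r : ℕ} {X : Type*} [TopologicalSpace X] [T2Space X]
    [SecondCountableTopology X] [MeasurableSpace X] [BorelSpace X]
    [ChartedSpace (SHM.Cn n) X] [IsManifold 𝓘(ℂ, SHM.Cn n) ω X]
    {E : X → Type*} [∀ x, AddCommGroup (E x)] [∀ x, Module ℂ (E x)]
    [TopologicalSpace (TotalSpace (SHM.Cn r) E)] [∀ x, TopologicalSpace (E x)]
    [FiberBundle (SHM.Cn r) E] [VectorBundle ℂ (SHM.Cn r) E]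
    [ContMDiffVectorBundle ω (SHM.Cn r) E 𝓘(ℂ, SHM.Cn n)]
    (h : SHM.SingularHermitianMetric n r E) (hG : h.GriffithsSemipositiveOn univ)
    (S : Set X) (hS : SHM.IsAnalyticSubset n S)
    (hproper : ∀ x : X, ¬ connectedComponent x ⊆ S)
    (hStein : SHM.IsSteinOn n Sᶜ)
    (hN : h.GloballyNakanoSemipositiveOn Sᶜ) :
    h.GloballyNakanoSemipositiveOn univ := by
  classical
  refine ⟨hG, fun Ω s κ ψ _ hΩ hs hκ hψ q k hq hqn hk f hf hfd hfin => ?_⟩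
  have hint := hS.interior_eq_empty hproper
  have hSm : MeasurableSet S := (isOpen_compl_iff.1 hStein.1).measurableSet
  have hvol : ∀ c : X, volume (SHM.chartSet n c S) = 0 := hS.volume_chartSet_eq_zero hint
  have hκS : SHM.kahlerVolume κ S = 0 := SHM.kahlerVolume_eq_zero κ hSm hvol
  have hsub : Ω ∩ Sᶜ ⊆ Ω := inter_subset_left
  have hΩ' := hΩ.inter hStein
  -- Measurability in charts does not see `S`, either.
  have hres : ∀ c : X, volume.restrict (SHM.chartSet n c (Ω ∩ Sᶜ)) =
      volume.restrict (SHM.chartSet n c Ω) := by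
    intro c
    refine Measure.restrict_congr_set ?_
    have h1 : SHM.chartSet n c (Ω ∩ Sᶜ) = SHM.chartSet n c Ω \ SHM.chartSet n c S := by
      ext z
      simp only [SHM.chartSet, mem_inter_iff, mem_preimage, mem_compl_iff, Set.mem_sdiff]
      tauto
    rw [h1]
    exact sdiff_null_ae_eq_self (hvol c)
  have hf' : h.MemL2 n q s κ ψ (Ω ∩ Sᶜ) f := by
    refine ⟨fun x hx => hf.1 x hx.1, fun c => ?_, ?_⟩
    · rw [hres]
      exact hf.2.1 c
    · rw [h.energy_diff_null hκS]
      exact hf.2.2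
  obtain ⟨u, hu, hud, hule⟩ := hN.2 (Ω ∩ Sᶜ) s κ ψ inter_subset_right hΩ'
    ⟨fun i => (hs.1 i).mono hsub, fun x hx => hs.2 x hx.1⟩ (hκ.mono hsub)
    ⟨hψ.1.mono hsub, fun x hx => hψ.2 x hx.1⟩ q k hq hqn hk f hf' (hfd.mono hsub)
    (by rwa [h.energy_diff_null hκS])
  -- The solution off `S`, extended by zero; it has to be of type `(n, q - 1)` on `S`, too.
  let u' : X → SHM.Form n (k + 1) (SHM.Cn r) := fun x => if x ∈ S then 0 else u x
  have huu' : ∀ x ∈ Ω ∩ Sᶜ, u x = u' x := fun x hx => (if_neg hx.2).symm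
  have henergy : h.energy s κ ψ Ω u' u' = h.energy s κ ψ (Ω ∩ Sᶜ) u u := by
    rw [h.energy_congr hΩ'.1 huu' huu', h.energy_diff_null hκS]
  have hmeas : ∀ c : X, AEStronglyMeasurable (SHM.pull c u')
      (volume.restrict (SHM.chartSet n c Ω)) := by
    intro c
    rw [← hres]
    refine (hu.2.1 c).congr ?_
    filter_upwards [ae_restrict_mem (SHM.isOpen_chartSet c hΩ'.1).measurableSet] with z hz
    rw [SHM.pull, SHM.pull, huu' _ hz.2]
  have hfin' : h.energy s κ ψ Ω u' u' < ⊤ := by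
    rw [henergy]
    exact hu.2.2
  refine ⟨u', ⟨fun x hx => ?_, hmeas, hfin'⟩, ?_, ?_⟩
  · by_cases hxS : x ∈ S
    · intro c v
      simp [u', hxS]
    · rw [← huu' x ⟨hx, hxS⟩]
      exact hu.1 x ⟨hx, hxS⟩
  · refine SHM.WeakDbarOn.extend_across hΩ.1 hS hint (fun c z hz => ?_) (fun c => (hfd c).1)
      (hud.congr hΩ'.1 huu')
    have hGΩ : h.GriffithsSemipositiveOn Ω := fun U ξ hU _ => hG U ξ hU (subset_univ _)
    exact SHM.exists_nhds_memLp_pull h hΩ.1 hκ hψ.1.continuousOn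
      (fun x₀ hx₀ => hGΩ.exists_lower_bound hΩ.1 hs hx₀) hmeas hfin' c hz
  · rw [henergy]
    exact hule.trans (h.energy_diff_null hκS _ _).le
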